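/- **Notation.** Let $k\ge 0$, $n\ge 1$, $[n]=\{1,\dots,n\}$. $\mathrm{Gr}_{k,n}^{\ge 0}$ (resp. $\mathrm{Gr}_{k,n}^{>0}$) is the set of $k$-dimensional subspaces of $\mathbb R^n$ that are the row span of a real $k\times n$ matrix all of whose $k\times k$ minors are nonnegative (resp. positive). For $\sigma\in\{0,+,-\}^n$ let $\mathrm{var}(\sigma)$ be the number of sign changes of $\sigma$ ignoring zeros ($\mathrm{var}(0):=-1$), and $\overline{\mathrm{var}}(\sigma):=\max\{\mathrm{var}(\tau):\tau_i=\sigma_i\text{ whenever }\sigma_i\ne 0\}$. Write $\sigma\le\tau$ if $\sigma_i=\tau_i$ whenever $\sigma_i\neq 0$. Let $\overline{\mathrm{Sign}_{n,k,1}}$ be the set of nonzero $\sigma\in\{0,+,-\}^n$ with $\overline{\mathrm{var}}(\sigma)=k$ whose first nonzero component, in position $i$, equals $(-1)^{i-1}$. Let $W\in\mathrm{Gr}_{k+1,n}^{>0}$ (so $k<n$). Put $\mathcal B_{n,k,1}(W):=\{V^\perp\cap W: V\in\mathrm{Gr}_{k,n}^{\ge 0}\}$. It is stratified by the sets $\mathcal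 B_\sigma(W)$ of lines spanned by nonzero $w\in W$ with $\mathrm{sign}(w)=\pm\sigma$, where $\sigma$ runs over the nonzero sign vectors with $\overline{\mathrm{var}}(\sigma)=k$, modulo $\pm1$. Strata are ordered by $S\le T\iff S\subseteq\overline{T}$. Let $w^{(0)},\dots,w^{(k)}$ be a basis of $W$ such that $V:=\mathrm{span}(w^{(1)},\dots,w^{(k)})\in\mathrm{Gr}_{k,n}^{>0}$ and $w^{(0)}$ is positively oriented with respect to $V$, i.e. the vector $u\in V^\perp\cap(V+\mathbb R w^{(0)})$ with $w^{(0)}-u\in V$ has $u_1>0$. The cyclic arrangement $\mathcal H^W$ in $\mathbb R^k$ consists of the $n$ hyperplanes $H_i=\{x: w^{(1)}_ix_1+\dots+w^{(k)}_ix_k+w^{(0)}_i=0\}$, $i\in[n]$. Let $$\psi(x)=\mathrm{sign}\Big(\sum_{j=1}^k x_jw^{(j)}+w^{(0)}\Big)\in\{0,+,-\}^n,\qquad \Psi(x)=\Big\langle \sum_{j=1}^k x_jw^{(j)}+w^{(0)}\Big\rangle\in\mathbb P(W)\qquad(x\in\mathbb R^k).$$ The faces of $\mathcal H^W$ are the nonempty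 fibers $\psi^{-1}(\sigma)$ (the face labeled by $\sigma$), also ordered by $S\le T\iff S\subseteq\overline T$, and $B(\mathcal H^W)\subseteq\mathbb R^k$ is the union of the bounded faces, which are its strata. **Theorem.** For all such $W$ and all such bases: 1. Each $V^\perp\cap W$ with $V\in\mathrm{Gr}_{k,n}^{\ge0}$ is a line, so $\mathcal B_{n,k,1}(W)\subseteq\mathbb P(W)$, and the restriction of $\Psi$ to $B(\mathcal H^W)$ is a homeomorphism from $B(\mathcal H^W)$ onto $\mathcal B_{n,k,1}(W)$. 2. The labels of the bounded faces of $\mathcal H^W$ are exactly the elements of $\overline{\mathrm{Sign}_{n,k,1}}$, and $\Psi(\psi^{-1}(\sigma))=\mathcal B_\sigma(W)$ for all $\sigma\in\overline{\mathrm{Sign}_{n,k,1}}$. 3. $F\mapsto\Psi(F)$ is an isomorphism of posets from the strata (bounded faces) of $B(\mathcal H^W)$ to the strata of $\mathcal B_{n,k,1}(W)$. In terms of labels, for $\sigma,\tau\in\overline{\mathrm{Sign}_{n,k,1}}$: $\psi^{-1}(\sigma)\subseteq\overline{\psi^{-1}(\tau)}\iff\sigma\le\tau\iff\mathcal B_\sigma(W)\subseteq\overline{\mathcal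 B_\tau(W)}$. -/

import Mathlib

open scoped LinearAlgebra.Projectivization

namespace CyclicArrangement

/-! ### Sign vectors and sign variation -/

/-- Sign vectors, i.e. elements of `{0,+,-}^n`. -/
abbrev SignVec (n : ℕ) : Type := Fin n → SignType

/-- The sign vector of a real vector. -/
noncomputable def signVec {n : ℕ} (v : EuclideanSpace ℝ (Fin n)) : SignVec n :=
  fun i => SignType.sign (v i)

/-- The partial order on sign vectors: `σ ≤ τ` iff `σ` is obtained from `τ` by setting some
components to zero. (This is not the pointwise order coming from `-1 < 0 < 1`.) -/
def signLE {n : ℕ} (σ τ : SignVec n) : Prop :=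
  ∀ i, σ i ≠ 0 → σ i = τ i

instance {n : ℕ} (σ τ : SignVec n) : Decidable (signLE σ τ) :=
  inferInstanceAs (Decidable (∀ i, σ i ≠ 0 → σ i = τ i))

/-- The number of sign changes of `σ`, ignoring zeros; the value at the zero vector is `-1`.
Deleting the zeros and merging equal neighbours leaves a list with one more entry than there are
sign changes (and the empty list for the zero vector). -/
def var {n : ℕ} (σ : SignVec n) : ℤ :=
  ((((List.ofFn σ).filter (· ≠ 0)).destutter (· ≠ ·)).length : ℤ) - 1

/-- The maximum of `var τ` over all `τ` that agree with `σ` wherever `σ` is nonzero. -/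
def varBar {n : ℕ} (σ : SignVec n) : ℤ :=
  (Finset.univ.filter fun τ : SignVec n => signLE σ τ).sup'
    ⟨σ, Finset.mem_filter.2 ⟨Finset.mem_univ _, fun _ _ => rfl⟩⟩ var

/-- The nonzero sign vectors `σ` with `varBar σ = k` whose first nonzero component, in position
`i` (counted from `0`), is `(-1)^i`. -/
def signBar (n k : ℕ) : Set (SignVec n) :=
  {σ | σ ≠ 0 ∧ varBar σ = k ∧ ∀ i, σ i ≠ 0 → (∀ j < i, σ j = 0) → σ i = (-1) ^ (i : ℕ)}

/-! ### The totally nonnegative and totally positive Grassmannians -/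

/-- The rows of the `k × n` matrix `A` form a basis of `V`; in particular `dim V = k`. -/
def Represents {n k : ℕ} (A : Matrix (Fin k) (Fin n) ℝ)
    (V : Submodule ℝ (EuclideanSpace ℝ (Fin n))) : Prop :=
  LinearIndependent ℝ (fun i => WithLp.toLp 2 (A i) : Fin k → EuclideanSpace ℝ (Fin n)) ∧
    Submodule.span ℝ
      (Set.range (fun i => WithLp.toLp 2 (A i) : Fin k → EuclideanSpace ℝ (Fin n))) = V

/-- `V ∈ Gr_{k,n}^{≥0}`: `V` has dimension `k` and, for a suitable representing matrix, all its
Plücker coordinates are nonnegative. -/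
def IsTotallyNonneg {n : ℕ} (k : ℕ) (V : Submodule ℝ (EuclideanSpace ℝ (Fin n))) : Prop :=
  ∃ A : Matrix (Fin k) (Fin n) ℝ, Represents A V ∧
    ∀ I : Fin k ↪o Fin n, 0 ≤ (A.submatrix id I).det

/-- `V ∈ Gr_{k,n}^{>0}`: `V` has dimension `k` and, for a suitable representing matrix, all its
Plücker coordinates are positive. -/
def IsTotallyPositive {n : ℕ} (k : ℕ) (V : Submodule ℝ (EuclideanSpace ℝ (Fin n))) : Prop :=
  ∃ A : Matrix (Fin k) (Fin n) ℝ, Represents A V ∧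
    ∀ I : Fin k ↪o Fin n, 0 < (A.submatrix id I).det

/-! ### The projective space of `W` and the `m = 1` amplituhedron -/

/-- The usual topology on projective space: the quotient topology from the nonzero vectors. -/
noncomputable instance instTopologicalSpaceProjectivization {E : Type*} [AddCommGroup E] [Module ℝ E]
    [TopologicalSpace E] : TopologicalSpace (ℙ ℝ E) :=
  TopologicalSpace.coinduced (Projectivization.mk' ℝ) inferInstance

/-- A point of `ℙ(W)`, regarded as a line in `ℝ^n`. -/
noncomputable def lineOf {n : ℕ} {W : Submodule ℝ (EuclideanSpace ℝ (Fin n))} (p : ℙ ℝ W) :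
    Submodule ℝ (EuclideanSpace ℝ (Fin n)) :=
  p.submodule.map W.subtype

/-- The amplituhedron `{V^⊥ ∩ W : V ∈ Gr_{k,n}^{≥0}}`, as a set of subspaces of `ℝ^n`. -/
def amplituhedronSubspaces {n : ℕ} (k : ℕ) (W : Submodule ℝ (EuclideanSpace ℝ (Fin n))) :
    Set (Submodule ℝ (EuclideanSpace ℝ (Fin n))) :=
  {X | ∃ V, IsTotallyNonneg k V ∧ X = Vᗮ ⊓ W}

/-- The amplituhedron `B_{n,k,1}(W)` as a subset of `ℙ(W)`. -/
def amplituhedron {n : ℕ} (k : ℕ) (W : Submodule ℝ (EuclideanSpace ℝ (Fin n))) :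
    Set (ℙ ℝ W) :=
  {p | lineOf p ∈ amplituhedronSubspaces k W}

/-- The stratum `B_σ(W)`: the lines spanned by nonzero `w ∈ W` with `sign w = ± σ`. -/
def stratum {n : ℕ} (W : Submodule ℝ (EuclideanSpace ℝ (Fin n))) (σ : SignVec n) :
    Set (ℙ ℝ W) :=
  {p | ∃ (w : W) (hw : w ≠ 0), p = Projectivization.mk ℝ w hw ∧
    (signVec (w : EuclideanSpace ℝ (Fin n)) = σ ∨ signVec (w : EuclideanSpace ℝ (Fin n)) = -σ)}

/-- The strata of `B_{n,k,1}(W)`, indexed by the nonzero `σ` with `varBar σ = k` modulo sign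
(note `stratum W σ = stratum W (-σ)`). -/
def strata {n : ℕ} (k : ℕ) (W : Submodule ℝ (EuclideanSpace ℝ (Fin n))) :
    Set (Set (ℙ ℝ W)) :=
  {S | ∃ σ : SignVec n, σ ≠ 0 ∧ varBar σ = k ∧ S = stratum W σ}

/-- The order on a collection of strata by containment of closures:
`S ≤ T` iff `S ⊆ closure T`. -/
def closureLE {X : Type*} [TopologicalSpace X] (𝒮 : Set (Set X)) : 𝒮 → 𝒮 → Prop :=
  fun S T => (S : Set X) ⊆ closure (T : Set X)

/-! ### The cyclic hyperplane arrangement of a basis of `W` -/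

/-- `w` is positively oriented with respect to `V`: the component `u` of `w` in
`V^⊥ ∩ (V + ℝ w)`, i.e. the element `u` with `w - u ∈ V`, has positive first coordinate. -/
def IsPositivelyOriented {n : ℕ} (V : Submodule ℝ (EuclideanSpace ℝ (Fin n)))
    (w : EuclideanSpace ℝ (Fin n)) : Prop :=
  ∃ u ∈ Vᗮ ⊓ (V ⊔ Submodule.span ℝ {w}), w - u ∈ V ∧ ∃ i : Fin n, (i : ℕ) = 0 ∧ 0 < u i

/-- The span `V` of the basis vectors `w^(1), …, w^(k)` (without `w^(0)`). -/
def linearPart {n k : ℕ} {W : Submodule ℝ (EuclideanSpace ℝ (Fin n))}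
    (b : Module.Basis (Fin (k + 1)) ℝ W) : Submodule ℝ (EuclideanSpace ℝ (Fin n)) :=
  Submodule.span ℝ (Set.range fun j : Fin k => ((b j.succ : W) : EuclideanSpace ℝ (Fin n)))

/-- The conditions on a basis `w^(0), …, w^(k)` of `W` that make it define a cyclic hyperplane
arrangement: `w^(1), …, w^(k)` span a totally positive subspace, with respect to which `w^(0)` is
positively oriented. -/
def IsCyclicBasis {n k : ℕ} {W : Submodule ℝ (EuclideanSpace ℝ (Fin n))}
    (b : Module.Basis (Fin (k + 1)) ℝ W) : Prop :=
  IsTotallyPositive k (linearPart b) ∧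
    IsPositivelyOriented (linearPart b) ((b 0 : W) : EuclideanSpace ℝ (Fin n))

/-- The vector `x₁ w^(1) + ⋯ + x_k w^(k) + w^(0)` of `W`. -/
noncomputable def vecAt {n k : ℕ} {W : Submodule ℝ (EuclideanSpace ℝ (Fin n))}
    (b : Module.Basis (Fin (k + 1)) ℝ W) (x : EuclideanSpace ℝ (Fin k)) : W :=
  (∑ j : Fin k, x j • b j.succ) + b 0

theorem vecAt_ne_zero {n k : ℕ} {W : Submodule ℝ (EuclideanSpace ℝ (Fin n))}
    (b : Module.Basis (Fin (k + 1)) ℝ W) (x : EuclideanSpace ℝ (Fin k)) : vecAt b x ≠ 0 := by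
  intro h
  have h1 := congrArg (fun w => b.repr w 0) h
  simp [vecAt, Fin.succ_ne_zero] at h1

/-- The `i`-th hyperplane of the arrangement,
`{x : w^(1)_i x₁ + ⋯ + w^(k)_i x_k + w^(0)_i = 0}`. -/
def hyperplane {n k : ℕ} {W : Submodule ℝ (EuclideanSpace ℝ (Fin n))}
    (b : Module.Basis (Fin (k + 1)) ℝ W) (i : Fin n) : Set (EuclideanSpace ℝ (Fin k)) :=
  {x | (∑ j : Fin k, ((b j.succ : W) : EuclideanSpace ℝ (Fin n)) i * x j) +
    ((b 0 : W) : EuclideanSpace ℝ (Fin n)) i = 0}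

/-- The map `ψ : ℝ^k → {0,+,-}^n`, recording on which side of each hyperplane a point lies. -/
noncomputable def psi {n k : ℕ} {W : Submodule ℝ (EuclideanSpace ℝ (Fin n))}
    (b : Module.Basis (Fin (k + 1)) ℝ W) (x : EuclideanSpace ℝ (Fin k)) : SignVec n :=
  signVec (vecAt b x : EuclideanSpace ℝ (Fin n))

theorem psi_eq_zero_iff {n k : ℕ} {W : Submodule ℝ (EuclideanSpace ℝ (Fin n))}
    (b : Module.Basis (Fin (k + 1)) ℝ W) (x : EuclideanSpace ℝ (Fin k)) (i : Fin n) :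
    psi b x i = 0 ↔ x ∈ hyperplane b i := by
  simp [psi, signVec, vecAt, hyperplane, sign_eq_zero_iff, mul_comm]

/-- The map `Ψ : ℝ^k → ℙ(W)`, `x ↦ ⟨x₁ w^(1) + ⋯ + x_k w^(k) + w^(0)⟩`. -/
noncomputable def Psi {n k : ℕ} {W : Submodule ℝ (EuclideanSpace ℝ (Fin n))}
    (b : Module.Basis (Fin (k + 1)) ℝ W) (x : EuclideanSpace ℝ (Fin k)) : ℙ ℝ W :=
  Projectivization.mk ℝ (vecAt b x) (vecAt_ne_zero b x)

/-- The (relatively open) face labeled by `σ`; it is a face of the arrangement when nonempty. -/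
def face {n k : ℕ} {W : Submodule ℝ (EuclideanSpace ℝ (Fin n))}
    (b : Module.Basis (Fin (k + 1)) ℝ W) (σ : SignVec n) : Set (EuclideanSpace ℝ (Fin k)) :=
  psi b ⁻¹' {σ}

/-- The labels of the bounded faces. -/
def boundedLabels {n k : ℕ} {W : Submodule ℝ (EuclideanSpace ℝ (Fin n))}
    (b : Module.Basis (Fin (k + 1)) ℝ W) : Set (SignVec n) :=
  {σ | (face b σ).Nonempty ∧ Bornology.IsBounded (face b σ)}

/-- The bounded faces. -/
def boundedFaces {n k : ℕ} {W : Submodule ℝ (EuclideanSpace ℝ (Fin n))}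
    (b : Module.Basis (Fin (k + 1)) ℝ W) : Set (Set (EuclideanSpace ℝ (Fin k))) :=
  face b '' boundedLabels b

/-- The complex of bounded faces, as a subset of `ℝ^k`. -/
def boundedComplex {n k : ℕ} {W : Submodule ℝ (EuclideanSpace ℝ (Fin n))}
    (b : Module.Basis (Fin (k + 1)) ℝ W) : Set (EuclideanSpace ℝ (Fin k)) :=
  ⋃₀ boundedFaces b

end CyclicArrangement

/-!
Everything rests on the relation between total positivity and sign variation. In terms of
subsequences, `k ≤ varBar (signVec w)` means that `w` weakly alternates along `k + 1` positions
(`le_varBar_signVec_iff`).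

* A nonzero element of a totally positive space of dimension `k` has `varBar < k`
  (`IsTotallyPositive.varBar_lt`): expanding a determinant with a repeated row gives a relation
  `∑ ± w (f j) * minor = 0`, in which all terms would have the same sign.
* A nonzero vector orthogonal to a totally nonnegative space of dimension `k` has `varBar ≥ k`
  (`IsTotallyNonneg.le_varBar`). A vector `w` with `varBar < k` has the signs of the values at
  `0, …, n - 1` of a polynomial of degree less than `k`, since zeros and sign changes can be read off
  greedily from the left (`exists_polynomial_aux`). So `w` lies in a rescaled space of polynomials,
  which is totally positive by Vandermonde's formula, and the Cauchy–Binet formula excludes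
  orthogonality (`det_mul_transpose_pos`). Conversely, a vector that weakly alternates along `k + 1`
  positions is orthogonal to a totally nonnegative space supported there
  (`exists_isTotallyNonneg_mem_orthogonal`).
* Every `σ` with `varBar σ < k` is the sign vector of an element of a given totally positive space of
  dimension `k` (`IsTotallyPositive.exists_signVec_eq`), by a theorem of the alternative.

Hence the lines `Vᗮ ⊓ W` are those spanned by `w ∈ W` with `varBar (signVec w) = k`. Such a `w` is not
in the linear part of the basis, so its line is in the image of the affine chart `Ψ`, which is an
open embedding. The functional `altSum A f` on `W`, a determinant vanishing on the linear part,
is positive on `b 0` by the orientation condition (`altSum_basis_zero_pos`). It determines the sign of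
the first nonzero entry of `vecAt b x` (`first_entry_mul_repr_pos`), and its constancy on the affine
space of the vectors `vecAt b x` bounds the faces with `varBar σ = k` (`isBounded_face`), whereas a
face with `varBar σ < k` contains a half-line in the direction of an element of the linear part with
sign vector `σ` (`not_isBounded_face`). The closure relations hold in `ℝ^k` by convexity and are
transported by `Ψ`.
-/

namespace CyclicArrangement

/-! ### A symmetrized Cauchy–Binet formula -/

/-- Summing over all column sequences, rather than the increasing ones, counts every set of columns
`k!` times and makes the formula a direct consequence of multilinearity. -/
theorem factorial_mul_det_mul_transpose {n k : ℕ} (A B : Matrix (Fin k) (Fin n) ℝ) :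
    (k.factorial : ℝ) * (A * B.transpose).det =
      ∑ p : Fin k → Fin n, (A.submatrix id p).det * (B.submatrix id p).det := by
  have h1 : (A * B.transpose).det =
      ∑ p : Fin k → Fin n, (∏ i, B i (p i)) * (A.submatrix id p).det := by
    have : (A * B.transpose).transpose =
        fun i => ∑ q : Fin n, B i q • (fun r => A r q) := by
      ext i r
      simp [Matrix.mul_apply, mul_comm]
    rw [← Matrix.det_transpose, this]
    change Matrix.detRowAlternating.toMultilinearMap _ = _
    rw [MultilinearMap.map_sum]
    refine Finset.sum_congr rfl fun p _ => ?_
    rw [MultilinearMap.map_smul_univ, ← Matrix.det_transpose (A.submatrix id p)]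
    rfl
  have h2 : ∀ π : Equiv.Perm (Fin k), (A * B.transpose).det =
      ∑ p : Fin k → Fin n, (A.submatrix id p).det *
        ((Equiv.Perm.sign π : ℤ) * ∏ i, B i (p (π i))) := by
    intro π
    rw [h1, ← Equiv.sum_comp (Equiv.arrowCongr π.symm (Equiv.refl (Fin n)))]
    refine Finset.sum_congr rfl fun p _ => ?_
    have : (A.submatrix id (p ∘ π)).det = (Equiv.Perm.sign π : ℤ) * (A.submatrix id p).det := by
      have := Matrix.det_permute' π (A.submatrix id p)
      rw [Matrix.submatrix_submatrix] at this
      simpa using this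
    have e : (Equiv.arrowCongr π.symm (Equiv.refl (Fin n))) p = p ∘ π := by
      ext; simp [Equiv.arrowCongr]
    rw [e, this]
    simp only [Function.comp]
    ring
  have h3 : ∀ p : Fin k → Fin n, (B.submatrix id p).det =
      ∑ π : Equiv.Perm (Fin k), ((Equiv.Perm.sign π : ℤ) : ℝ) * ∏ i, B i (p (π i)) := by
    intro p
    rw [← Matrix.det_transpose, Matrix.det_apply']
    simp
  simp_rw [h3, Finset.mul_sum]
  rw [Finset.sum_comm, ← Finset.sum_congr rfl (fun π _ => h2 π)]
  simp [Fintype.card_perm]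

/-- Sorting the columns: a maximal minor with columns `p` vanishes for all matrices, or is, up to a
sign not depending on the matrix, a minor with increasing columns. -/
theorem det_submatrix_eq_zero_or_eq_mul {n k : ℕ} (p : Fin k → Fin n) :
    (∀ M : Matrix (Fin k) (Fin n) ℝ, (M.submatrix id p).det = 0) ∨
      ∃ (I : Fin k ↪o Fin n) (ε : ℝ), ε * ε = 1 ∧
        ∀ M : Matrix (Fin k) (Fin n) ℝ, (M.submatrix id p).det = ε * (M.submatrix id I).det := by
  by_cases hp : Function.Injective p
  · right
    have hmono : StrictMono (p ∘ Tuple.sort p) :=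
      (Tuple.monotone_sort p).strictMono_of_injective (hp.comp (Tuple.sort p).injective)
    have hs : ((Equiv.Perm.sign (Tuple.sort p) : ℤ) : ℝ) * (Equiv.Perm.sign (Tuple.sort p) : ℤ)
        = 1 := by
      exact_mod_cast Int.units_coe_mul_self _
    refine ⟨OrderEmbedding.ofStrictMono _ hmono, _, hs, fun M => ?_⟩
    have := Matrix.det_permute' (Tuple.sort p) (M.submatrix id p)
    rw [Matrix.submatrix_submatrix, Function.id_comp] at this
    rw [OrderEmbedding.coe_ofStrictMono, this, ← mul_assoc, hs, one_mul]
  · left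
    obtain ⟨i, j, hij, hne⟩ : ∃ i j, p i = p j ∧ i ≠ j := by
      simpa [Function.Injective] using hp
    exact fun M => Matrix.det_zero_of_column_eq hne (by simp [hij])

/-- Consequently, no nonzero element of the row space of a totally positive matrix `B` is orthogonal
to all rows of a totally nonnegative matrix `A` with a positive maximal minor. -/
theorem det_mul_transpose_pos {n k : ℕ} {A B : Matrix (Fin k) (Fin n) ℝ}
    (hA : ∀ I : Fin k ↪o Fin n, 0 ≤ (A.submatrix id I).det)
    (hA' : ∃ I : Fin k ↪o Fin n, 0 < (A.submatrix id I).det)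
    (hB : ∀ I : Fin k ↪o Fin n, 0 < (B.submatrix id I).det) :
    0 < (A * B.transpose).det := by
  obtain ⟨I, hI⟩ := hA'
  have h : 0 < (k.factorial : ℝ) * (A * B.transpose).det := by
    rw [factorial_mul_det_mul_transpose]
    refine Finset.sum_pos' (fun p _ => ?_) ⟨I, Finset.mem_univ _, mul_pos hI (hB I)⟩
    rcases det_submatrix_eq_zero_or_eq_mul p with h0 | ⟨J, ε, hε, h0⟩
    · rw [h0, zero_mul]
    · rw [h0, h0, mul_mul_mul_comm, hε, one_mul]
      exact mul_nonneg (hA J) (hB J).le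
  exact pos_of_mul_pos_right h (by positivity)

/-- A matrix with independent rows has a nonzero maximal minor. -/
theorem exists_det_submatrix_ne_zero {n k : ℕ} {A : Matrix (Fin k) (Fin n) ℝ}
    (hA : ∀ c : Fin k → ℝ, Matrix.vecMul c A = 0 → c = 0) :
    ∃ I : Fin k ↪o Fin n, (A.submatrix id I).det ≠ 0 := by
  by_contra! h
  have h0 : (k.factorial : ℝ) * (A * A.transpose).det = 0 := by
    rw [factorial_mul_det_mul_transpose]
    refine Finset.sum_eq_zero fun p _ => ?_
    rcases det_submatrix_eq_zero_or_eq_mul p with h1 | ⟨J, ε, -, h1⟩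
    · rw [h1, zero_mul]
    · rw [h1, h J, mul_zero, zero_mul]
  have h1 : (A * A.transpose).det = 0 := by
    rcases mul_eq_zero.1 h0 with h | h
    · exact absurd h (by positivity)
    · exact h
  obtain ⟨c, hc, hc0⟩ := Matrix.exists_vecMul_eq_zero_iff.2 h1
  refine hc (hA c ?_)
  have : Matrix.vecMul c A ⬝ᵥ Matrix.vecMul c A = 0 := by
    rw [← Matrix.vecMul_vecMul, Matrix.vecMul_transpose] at hc0
    rw [← Matrix.dotProduct_mulVec, hc0, dotProduct_zero]
  exact dotProduct_self_eq_zero.1 this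

/-! ### Sign variation and alternating subsequences -/

/-- `σ` weakly alternates along the increasing sequence of positions `f`, starting with the
sign `s`: its entries there are `s, -s, s, …` up to replacing some of them by zero. -/
def WeaklyAlternates {n r : ℕ} (σ : SignVec n) (f : Fin r ↪o Fin n) (s : SignType) : Prop :=
  ∀ j, σ (f j) = 0 ∨ σ (f j) = s * (-1) ^ (j : ℕ)

theorem signType_mul_neg_one_pow_ne_zero {s : SignType} (hs : s ≠ 0) (j : ℕ) :
    s * (-1) ^ j ≠ 0 := by
  rcases neg_one_pow_eq_or SignType j with h | h <;> rw [h] <;> revert s <;> decide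

/-- `List.destutter` extracts a longest subsequence without equal neighbours, so `var` is one less
than the length of a longest strictly alternating subsequence. -/
theorem le_var_iff {n : ℕ} (τ : SignVec n) (k : ℕ) :
    (k : ℤ) ≤ var τ ↔ ∃ f : Fin (k + 1) ↪o Fin n, ∃ s : SignType, s ≠ 0 ∧
      ∀ j, τ (f j) = s * (-1) ^ (j : ℕ) := by
  unfold var
  constructor
  · intro h
    set l := ((List.ofFn τ).filter (· ≠ 0)).destutter (· ≠ ·) with hl
    have hlen : k + 1 ≤ l.length := by omega
    have hsub : l.Sublist ((List.ofFn τ).filter (· ≠ 0)) := List.destutter_sublist _ _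
    have hchain : l.IsChain (· ≠ ·) := List.isChain_destutter _ _
    have hnz : ∀ a ∈ l, a ≠ 0 := fun a ha => by
      simpa using (List.mem_filter.1 (hsub.subset ha)).2
    obtain ⟨g, hg⟩ := List.sublist_iff_exists_fin_orderEmbedding_get_eq.1
      (hsub.trans List.filter_sublist)
    have halt : ∀ j (hj : j < l.length), l[j] = l[0] * (-1) ^ j := by
      intro j
      induction j with
      | zero => intro _; simp
      | succ j ih =>
        intro hj
        have h1 := List.isChain_iff_getElem.1 hchain j hj
        have h2 := hnz _ (List.getElem_mem (by omega : j < l.length))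
        have h3 := hnz _ (List.getElem_mem hj)
        have h4 : ∀ a b : SignType, a ≠ b → a ≠ 0 → b ≠ 0 → b = a * -1 := by decide
        rw [h4 _ _ h1 h2 h3, ih, pow_succ, mul_assoc]
    refine ⟨((Fin.castLEOrderEmb hlen).trans g).trans
      (Fin.castOrderIso (List.length_ofFn)).toOrderEmbedding, l[0], hnz _ (List.getElem_mem _), ?_⟩
    intro j
    have := hg (Fin.castLE hlen j)
    rw [List.get_eq_getElem, halt] at this
    simp only [List.get_eq_getElem, List.getElem_ofFn, Fin.val_castLE] at this
    exact this.symm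
  · rintro ⟨f, s, hs, hf⟩
    have hsub : (List.ofFn fun j : Fin (k + 1) => s * (-1) ^ (j : ℕ)).Sublist (List.ofFn τ) := by
      rw [List.sublist_iff_exists_fin_orderEmbedding_get_eq]
      refine ⟨((Fin.castOrderIso (List.length_ofFn)).toOrderEmbedding.trans f).trans
        (Fin.castOrderIso (List.length_ofFn).symm).toOrderEmbedding, fun j => ?_⟩
      simp only [List.get_eq_getElem, List.getElem_ofFn]
      exact (hf ⟨j, by simpa using j.2⟩).symm
    have hsub' := hsub.filter (· ≠ 0)
    rw [List.filter_eq_self.2] at hsub'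
    · have hchain : (List.ofFn fun j : Fin (k + 1) => s * (-1) ^ (j : ℕ)).IsChain (· ≠ ·) := by
        rw [List.isChain_iff_getElem]
        intro i hi
        have := signType_mul_neg_one_pow_ne_zero hs i
        simp only [List.getElem_ofFn, pow_succ, ← mul_assoc]
        revert this
        generalize s * (-1) ^ i = a
        revert a
        decide
      have := hchain.length_le_length_destutter_ne hsub'
      rw [List.length_ofFn] at this
      omega
    · intro a ha
      obtain ⟨j, rfl⟩ := (List.mem_ofFn' _ _).1 ha
      simpa using signType_mul_neg_one_pow_ne_zero hs j

/-- Similarly, `varBar` is one less than the length of a longest weakly alternating subsequence: the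
zeros in such a subsequence can be filled in so that it strictly alternates. -/
theorem le_varBar_iff {n : ℕ} (σ : SignVec n) (k : ℕ) :
    (k : ℤ) ≤ varBar σ ↔ ∃ f : Fin (k + 1) ↪o Fin n, ∃ s : SignType, s ≠ 0 ∧
      WeaklyAlternates σ f s := by
  unfold varBar
  refine (Finset.le_sup'_iff _).trans ?_
  constructor
  · rintro ⟨τ, hτ, hk⟩
    obtain ⟨f, s, hs, hf⟩ := (le_var_iff τ k).1 hk
    refine ⟨f, s, hs, fun j => ?_⟩
    rw [← hf j]
    by_cases h : σ (f j) = 0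
    · exact Or.inl h
    · exact Or.inr ((Finset.mem_filter.1 hτ).2 _ h)
  · rintro ⟨f, s, hs, hf⟩
    classical
    refine ⟨fun i => if σ i = 0 then Function.extend f (fun j => s * (-1) ^ (j : ℕ)) 0 i else σ i,
      Finset.mem_filter.2 ⟨Finset.mem_univ _, fun i hi => by simp [hi]⟩,
      (le_var_iff _ k).2 ⟨f, s, hs, fun j => ?_⟩⟩
    rw [f.injective.extend_apply]
    rcases hf j with h | h
    · simp [h]
    · simp [h]

theorem WeaklyAlternates.neg {n r : ℕ} {σ : SignVec n} {f : Fin r ↪o Fin n} {s : SignType}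
    (h : WeaklyAlternates σ f s) : WeaklyAlternates (-σ) f (-s) := fun j => by
  rcases h j with h | h
  · left; simp [h]
  · right; simp [h]

theorem varBar_neg {n k : ℕ} {σ : SignVec n} (h : varBar σ = k) : varBar (-σ) = k := by
  have key : ∀ (τ : SignVec n) (r : ℕ), (r : ℤ) ≤ varBar τ → (r : ℤ) ≤ varBar (-τ) := by
    intro τ r hr
    obtain ⟨f, s, hs, hf⟩ := (le_varBar_iff τ r).1 hr
    exact (le_varBar_iff _ r).2 ⟨f, -s, by simpa using hs, hf.neg⟩
  refine le_antisymm ?_ (key σ k h.ge)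
  by_contra! hlt
  have := key (-σ) (k + 1) (by push_cast; omega)
  rw [neg_neg, h] at this
  push_cast at this
  omega

theorem signType_sign_coe (s : SignType) : SignType.sign (s : ℝ) = s := by
  cases s <;> simp

/-- For sign vectors of real vectors, weak alternation is a family of linear inequalities. -/
theorem weaklyAlternates_sign_iff {n r : ℕ} {w : Fin n → ℝ} {f : Fin r ↪o Fin n} {t : ℝ}
    (ht : t ≠ 0) : WeaklyAlternates (fun i => SignType.sign (w i)) f (SignType.sign t) ↔
      ∀ j : Fin r, 0 ≤ t * (-1) ^ (j : ℕ) * w (f j) := by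
  refine forall_congr' fun j => ?_
  rw [← sign_nonneg_iff, sign_mul, sign_mul, sign_pow, Left.sign_neg, sign_one]
  have h := signType_mul_neg_one_pow_ne_zero (sign_ne_zero.2 ht) j
  change SignType.sign (w (f j)) = 0 ∨ SignType.sign (w (f j)) = _ ↔ _
  revert h
  generalize SignType.sign t * (-1) ^ (j : ℕ) = a
  generalize SignType.sign (w (f j)) = c
  revert a c
  decide

/-! ### Interpolation by polynomials with few roots -/

open Polynomial in
/-- The leading zeros and the first nonzero entry `w m` of `w` weakly alternate, and the leading
zeros are roots of `p`. Reading on from there, one adds a root to `p`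
exactly when an alternating subsequence of `w` can be prolonged: a zero of `w` is a root of `p`
and prolongs the subsequence, and so does an unexpected sign of `w`, which is accounted for by a
root halfway between two integers. Hence the number `d` of roots of `p` is controlled by the
alternating subsequence `f 0 < ⋯ < f d`. -/
theorem exists_polynomial_aux (w : ℕ → ℝ) (m : ℕ) (hm : ∀ i < m, w i = 0) (hwm : w m ≠ 0)
    (N : ℕ) (hN : m + 1 ≤ N) :
    ∃ (d : ℕ) (p : ℝ[X]), p.natDegree ≤ d ∧
      (∀ i < N, SignType.sign (p.eval (i : ℝ)) = SignType.sign (w i)) ∧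
      (∀ x : ℝ, (N : ℝ) - 1 < x → 0 < (-1) ^ m * w m * (-1) ^ d * p.eval x) ∧
      ∃ f : ℕ → ℕ, (∀ i j, i < j → j ≤ d → f i < f j) ∧ (∀ j ≤ d, f j < N) ∧
        ∀ j ≤ d, 0 ≤ (-1) ^ m * w m * (-1) ^ j * w (f j) := by
  induction N, hN using Nat.le_induction with
  | base =>
    refine ⟨m, C (w m) * ∏ i ∈ Finset.range m, (X - C (i : ℝ)), ?_, ?_, ?_, id, ?_, ?_, ?_⟩
    · refine natDegree_C_mul_le _ _ |>.trans ?_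
      rw [natDegree_prod_of_monic _ _ fun i _ => monic_X_sub_C _]
      simp only [natDegree_X_sub_C]
      simp
    · intro i hi
      rw [eval_mul, eval_C, eval_prod]
      rcases Nat.lt_succ_iff_lt_or_eq.1 hi with hi | rfl
      · rw [hm i hi, Finset.prod_eq_zero (Finset.mem_range.2 hi) (by simp), mul_zero]
      · rw [sign_mul, sign_pos (a := ∏ j ∈ Finset.range i, _), mul_one]
        refine Finset.prod_pos fun j hj => ?_
        have : (j : ℝ) < i := by exact_mod_cast Finset.mem_range.1 hj
        simpa using this
    · intro x hx
      push_cast at hx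
      rw [eval_mul, eval_C, eval_prod]
      have : 0 < ∏ j ∈ Finset.range m, eval x (X - C (j : ℝ)) := by
        refine Finset.prod_pos fun j hj => ?_
        have : (j : ℝ) < m := by exact_mod_cast Finset.mem_range.1 hj
        simp only [eval_sub, eval_X, eval_C]
        linarith
      have h2 : ((-1 : ℝ) ^ m) * (-1) ^ m = 1 := by rw [← mul_pow]; simp
      have h3 : 0 < w m * w m := mul_self_pos.2 hwm
      calc (0 : ℝ) < w m * w m * ∏ j ∈ Finset.range m, eval x (X - C (j : ℝ)) := by positivity
        _ = ((-1) ^ m * (-1) ^ m) * (w m * w m * ∏ j ∈ Finset.range m, eval x (X - C (j : ℝ))) := by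
          rw [h2, one_mul]
        _ = _ := by ring
    · exact fun i j hij _ => hij
    · exact fun j hj => Nat.lt_succ_of_le hj
    · intro j hj
      rcases hj.lt_or_eq with h | rfl
      · simp [hm j h]
      · have h2 : ((-1 : ℝ) ^ j) * (-1) ^ j = 1 := by rw [← mul_pow]; simp
        calc (0 : ℝ) ≤ w j * w j := mul_self_nonneg _
          _ = ((-1) ^ j * (-1) ^ j) * (w j * w j) := by rw [h2, one_mul]
          _ = _ := by simp only [id]; ring
  | succ N hN ih =>
    obtain ⟨d, p, hd, hsgn, hpos, f, hf, hfN, halt⟩ := ih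
    set s : ℝ := (-1) ^ m * w m with hs
    have hs0 : s ≠ 0 := mul_ne_zero (pow_ne_zero _ (by norm_num)) hwm
    have he0 : s * (-1) ^ d ≠ 0 := mul_ne_zero hs0 (pow_ne_zero _ (by norm_num))
    by_cases h : 0 < s * (-1) ^ d * w N
    · -- the expected sign: the last position is moved to `N`
      refine ⟨d, p, hd, ?_, ?_, Function.update f d N, ?_, ?_, ?_⟩
      · intro i hi
        rcases Nat.lt_succ_iff_lt_or_eq.1 hi with hi | rfl
        · exact hsgn i hi
        · have h1 := hpos (i : ℝ) (by linarith)
          have h2 := (sign_pos h1).trans (sign_pos h).symm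
          rw [sign_mul (s * (-1) ^ d), sign_mul (s * (-1) ^ d)] at h2
          have h3 : SignType.sign (s * (-1) ^ d) ≠ 0 := sign_ne_zero.2 he0
          exact mul_left_cancel₀ h3 h2
      · intro x hx
        push_cast at hx
        exact hpos x (by linarith)
      · intro i j hij hj
        rw [Function.update_of_ne (by omega)]
        rcases hj.lt_or_eq with hj' | rfl
        · rw [Function.update_of_ne (by omega)]
          exact hf i j hij hj
        · rw [Function.update_self]
          exact hfN i hij.le
      · intro j hj
        rcases hj.lt_or_eq with hj' | rfl
        · rw [Function.update_of_ne (by omega)]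
          exact (hfN j hj).trans (Nat.lt_succ_self _)
        · simp
      · intro j hj
        rcases hj.lt_or_eq with hj' | rfl
        · rw [Function.update_of_ne (by omega)]
          exact halt j hj
        · rw [Function.update_self]
          exact h.le
    · -- a zero or an unexpected sign: a root `r` is added and the subsequence is prolonged
      obtain ⟨r, hr1, hr2, hr3⟩ : ∃ r : ℝ, (N : ℝ) - 1 < r ∧ r ≤ N ∧
          SignType.sign (r - N) = -SignType.sign (s * (-1) ^ d) * -SignType.sign (w N) := by
        rcases (not_lt.1 h).lt_or_eq with h' | h'
        · refine ⟨N - 1 / 2, by linarith, by linarith, ?_⟩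
          rw [neg_mul_neg, ← sign_mul, sign_neg h', sign_neg (by linarith)]
        · refine ⟨N, by linarith, le_rfl, ?_⟩
          rcases mul_eq_zero.1 h' with h' | h'
          · exact absurd h' he0
          · simp [h']
      refine ⟨d + 1, p * (C r - X), ?_, ?_, ?_, Function.update f (d + 1) N, ?_, ?_, ?_⟩
      · refine natDegree_mul_le.trans (add_le_add hd ?_)
        exact (natDegree_sub_le _ _).trans (by simp)
      · intro i hi
        simp only [eval_mul, eval_sub, eval_C, eval_X]
        rcases Nat.lt_succ_iff_lt_or_eq.1 hi with hi | rfl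
        · have : (i : ℝ) + 1 ≤ N := by exact_mod_cast hi
          rw [sign_mul, hsgn i hi, sign_pos (a := r - i) (by linarith), mul_one]
        · have h1 := sign_pos (hpos (i : ℝ) (by linarith))
          rw [sign_mul] at h1
          rw [sign_mul, hr3, neg_mul_neg, ← mul_assoc, mul_comm (SignType.sign (eval _ p)), h1,
            one_mul]
      · intro x hx
        push_cast at hx
        have h1 := hpos x (by linarith)
        have h2 : 0 < x - r := by linarith
        simp only [eval_mul, eval_sub, eval_C, eval_X, pow_succ]
        nlinarith [mul_pos h1 h2]
      · intro i j hij hj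
        rw [Function.update_of_ne (by omega)]
        rcases hj.lt_or_eq with hj' | rfl
        · rw [Function.update_of_ne (by omega)]
          exact hf i j hij (by omega)
        · rw [Function.update_self]
          exact hfN i (by omega)
      · intro j hj
        rcases hj.lt_or_eq with hj' | rfl
        · rw [Function.update_of_ne (by omega)]
          exact (hfN j (by omega)).trans (Nat.lt_succ_self _)
        · simp
      · intro j hj
        rcases hj.lt_or_eq with hj' | rfl
        · rw [Function.update_of_ne (by omega)]
          exact halt j (by omega)
        · rw [Function.update_self, pow_succ]
          linarith [not_lt.1 h]

open Polynomial in
/-- A nonzero vector with first nonzero entry `w m` is interpolated in sign by a polynomial whose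
degree is less than the length of a weakly alternating subsequence starting with the sign of
`(-1) ^ m * w m`. -/
theorem exists_polynomial_alternating {n : ℕ} (w : Fin n → ℝ) (m : Fin n)
    (hm : ∀ i < m, w i = 0) (hwm : w m ≠ 0) :
    ∃ (d : ℕ) (p : ℝ[X]), p.natDegree ≤ d ∧
      (∀ i : Fin n, SignType.sign (p.eval (i : ℝ)) = SignType.sign (w i)) ∧
      ∃ f : Fin (d + 1) ↪o Fin n, ∀ j : Fin (d + 1),
        0 ≤ (-1) ^ (m : ℕ) * w m * (-1) ^ (j : ℕ) * w (f j) := by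
  set W : ℕ → ℝ := fun i => if h : i < n then w ⟨i, h⟩ else 0 with hW
  have hWw : ∀ i : Fin n, W i = w i := fun i => by simp [hW]
  obtain ⟨d, p, hd, hsgn, -, f, hf, hfN, halt⟩ := exists_polynomial_aux W m
    (fun i hi => by
      rw [← hm ⟨i, hi.trans m.2⟩ hi, ← hWw]) (by rwa [hWw]) n m.2
  refine ⟨d, p, hd, fun i => by rw [hsgn i i.2, hWw],
    OrderEmbedding.ofStrictMono (fun j => ⟨f j, hfN j (Nat.lt_succ_iff.1 j.2)⟩)
      (fun i j hij => hf i j hij (Nat.lt_succ_iff.1 j.2)), fun j => ?_⟩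
  have := halt j (Nat.lt_succ_iff.1 j.2)
  have e : W (f j) = _ := hWw ⟨f j, hfN j (Nat.lt_succ_iff.1 j.2)⟩
  rw [hWw, e] at this
  exact this

open Polynomial in
/-- A vector with the signs of a polynomial of degree less than `k` lies in a totally positive
`k`-dimensional space, namely a rescaled space of polynomials. -/
theorem exists_pos_minors_of_polynomial {n k : ℕ} (w : Fin n → ℝ) (p : ℝ[X])
    (hp : p.natDegree < k)
    (hsgn : ∀ i : Fin n, SignType.sign (p.eval (i : ℝ)) = SignType.sign (w i)) :
    ∃ U : Matrix (Fin k) (Fin n) ℝ, (∀ I : Fin k ↪o Fin n, 0 < (U.submatrix id I).det) ∧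
      ∃ c : Fin k → ℝ, Matrix.vecMul c U = w := by
  set g : Fin n → ℝ := fun i => if w i = 0 then 1 else w i / p.eval (i : ℝ) with hg
  have hgpos : ∀ i, 0 < g i := by
    intro i
    simp only [hg]
    split_ifs with h
    · exact one_pos
    · have h1 := hsgn i
      rcases lt_or_gt_of_ne h with h | h
      · rw [sign_neg h, sign_eq_neg_one_iff] at h1
        exact div_pos_of_neg_of_neg h h1
      · rw [sign_pos h, sign_eq_one_iff] at h1
        exact div_pos h h1
  refine ⟨Matrix.of fun j i => g i * (i : ℝ) ^ (j : ℕ), fun I => ?_, fun j => p.coeff j, ?_⟩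
  · have : (Matrix.of fun (j : Fin k) (i : Fin n) => g i * (i : ℝ) ^ (j : ℕ)).submatrix id I =
        (Matrix.of fun i j => g (I i) * Matrix.vandermonde (fun i => ((I i : Fin n) : ℝ)) i j).transpose := by
      ext i j
      simp [Matrix.vandermonde]
    rw [this, Matrix.det_transpose, Matrix.det_mul_column, Matrix.det_vandermonde]
    refine mul_pos (Finset.prod_pos fun i _ => hgpos _)
      (Finset.prod_pos fun i _ => Finset.prod_pos fun j hj => sub_pos.2 ?_)
    exact_mod_cast I.strictMono (Finset.mem_Ioi.1 hj)
  · ext i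
    have h1 : Matrix.vecMul (fun j : Fin k => p.coeff j)
        (Matrix.of fun (j : Fin k) (i : Fin n) => g i * (i : ℝ) ^ (j : ℕ)) i
        = g i * p.eval (i : ℝ) := by
      rw [Polynomial.eval_eq_sum_range' hp, Finset.mul_sum, Finset.sum_range]
      simp only [Matrix.vecMul, dotProduct, Matrix.of_apply]
      exact Finset.sum_congr rfl fun j _ => by ring
    rw [h1]
    have h2 := hsgn i
    simp only [hg]
    split_ifs with h
    · rw [h, sign_zero, sign_eq_zero_iff] at h2
      rw [h2, h, mul_zero]
    · refine div_mul_cancel₀ _ fun h0 => h ?_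
      rw [h0, sign_zero] at h2
      exact sign_eq_zero_iff.1 h2.symm

/-! ### Alternation and the row space of a totally positive matrix -/

/-- The determinant of the columns `f` of the matrix obtained from `A` by adding `w` as a first
row, expanded along that row. -/
noncomputable def altSum {n k : ℕ} (A : Matrix (Fin k) (Fin n) ℝ) (f : Fin (k + 1) ↪o Fin n)
    (w : Fin n → ℝ) : ℝ :=
  ∑ j : Fin (k + 1), (-1) ^ (j : ℕ) * w (f j) *
    (A.submatrix id ((Fin.succAboveOrderEmb j).trans f)).det

theorem altSum_eq_det {n k : ℕ} (A : Matrix (Fin k) (Fin n) ℝ) (f : Fin (k + 1) ↪o Fin n)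
    (w : Fin n → ℝ) : altSum A f w =
      (Matrix.submatrix (Matrix.of (Fin.cons w A : Fin (k + 1) → Fin n → ℝ)) id f).det := by
  rw [Matrix.det_succ_row_zero]
  rfl

theorem altSum_add {n k : ℕ} (A : Matrix (Fin k) (Fin n) ℝ) (f : Fin (k + 1) ↪o Fin n)
    (v w : Fin n → ℝ) : altSum A f (v + w) = altSum A f v + altSum A f w := by
  simp only [altSum, ← Finset.sum_add_distrib, Pi.add_apply]
  exact Finset.sum_congr rfl fun j _ => by ring

theorem altSum_smul {n k : ℕ} (A : Matrix (Fin k) (Fin n) ℝ) (f : Fin (k + 1) ↪o Fin n)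
    (t : ℝ) (w : Fin n → ℝ) : altSum A f (t • w) = t * altSum A f w := by
  simp only [altSum, Finset.mul_sum, Pi.smul_apply, smul_eq_mul]
  exact Finset.sum_congr rfl fun j _ => by ring

theorem altSum_vecMul {n k : ℕ} (A : Matrix (Fin k) (Fin n) ℝ) (f : Fin (k + 1) ↪o Fin n)
    (c : Fin k → ℝ) : altSum A f (Matrix.vecMul c A) = 0 := by
  rw [altSum_eq_det]
  refine Matrix.exists_vecMul_eq_zero_iff.1 ⟨Fin.cons (-1) c, fun h => ?_, ?_⟩
  · simpa using congrFun h 0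
  · ext j
    rw [Matrix.vecMul, dotProduct, Fin.sum_univ_succ]
    change -1 * Matrix.vecMul c A (f j) + ∑ i, c i * A i (f j) = 0
    rw [Matrix.vecMul, dotProduct]
    ring

/-- The row space of a totally positive matrix with `k` rows contains no nonzero vector that weakly
alternates along `k + 1` positions. -/
theorem eq_zero_of_alternating {n k : ℕ} {B : Matrix (Fin k) (Fin n) ℝ}
    (hB : ∀ I : Fin k ↪o Fin n, 0 < (B.submatrix id I).det) {c : Fin k → ℝ}
    {f : Fin (k + 1) ↪o Fin n} {t : ℝ} (ht : t ≠ 0)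
    (h : ∀ j : Fin (k + 1), 0 ≤ t * (-1) ^ (j : ℕ) * Matrix.vecMul c B (f j)) : c = 0 := by
  set w := Matrix.vecMul c B with hw
  have h0 : ∑ j : Fin (k + 1), (t * (-1) ^ (j : ℕ) * w (f j)) *
      (B.submatrix id ((Fin.succAboveOrderEmb j).trans f)).det = 0 := by
    have := altSum_vecMul B f c
    rw [← hw] at this
    calc _ = t * altSum B f w := by
            rw [altSum, Finset.mul_sum]
            exact Finset.sum_congr rfl fun j _ => by ring
      _ = 0 := by rw [this, mul_zero]
  rw [Finset.sum_eq_zero_iff_of_nonneg fun j _ => mul_nonneg (h j) (hB _).le] at h0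
  have hz : ∀ j, w (f j) = 0 := by
    intro j
    have h1 := h0 j (Finset.mem_univ j)
    have h2 : t * (-1) ^ (j : ℕ) ≠ 0 := mul_ne_zero ht (pow_ne_zero _ (by norm_num))
    exact (mul_eq_zero.1 ((mul_eq_zero.1 h1).resolve_right (hB _).ne')).resolve_left h2
  refine Matrix.eq_zero_of_vecMul_eq_zero (hB ((Fin.succAboveOrderEmb 0).trans f)).ne' ?_
  ext j
  exact hz _

theorem exists_first_ne_zero {n : ℕ} {α : Type*} [Zero α] {w : Fin n → α} (hw : w ≠ 0) :
    ∃ m, w m ≠ 0 ∧ ∀ i < m, w i = 0 := by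
  obtain ⟨i, hi⟩ := Function.ne_iff.1 hw
  obtain ⟨m, hm, hmin⟩ := WellFounded.has_min (wellFounded_lt (α := Fin n)) {i | w i ≠ 0} ⟨i, hi⟩
  exact ⟨m, hm, fun i hi => by_contra fun h => hmin i h hi⟩

/-- Dual of `eq_zero_of_alternating`: a nonzero vector in the kernel of a totally nonnegative matrix
`A` of rank `k` weakly alternates along `k + 1` positions, with a starting sign determined by its
first nonzero entry `w m`. Otherwise it would lie in a totally positive row space with `k`
generators, which meets the kernel of `A` only in zero by the Cauchy–Binet formula. -/
theorem exists_alternating_of_mulVec_eq_zero {n k : ℕ} {A : Matrix (Fin k) (Fin n) ℝ}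
    (hA : ∀ I : Fin k ↪o Fin n, 0 ≤ (A.submatrix id I).det)
    (hA' : ∃ I : Fin k ↪o Fin n, 0 < (A.submatrix id I).det)
    {w : Fin n → ℝ} (hAw : A.mulVec w = 0) {m : Fin n} (hwm : w m ≠ 0) (hm : ∀ i < m, w i = 0) :
    ∃ f : Fin (k + 1) ↪o Fin n,
      ∀ j : Fin (k + 1), 0 ≤ (-1) ^ (m : ℕ) * w m * (-1) ^ (j : ℕ) * w (f j) := by
  obtain ⟨d, p, hd, hsgn, f, hf⟩ := exists_polynomial_alternating w m hm hwm
  rcases lt_or_ge d k with hdk | hdk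
  · obtain ⟨U, hU, c, rfl⟩ := exists_pos_minors_of_polynomial w p (hd.trans_lt hdk) hsgn
    have h1 := det_mul_transpose_pos hA hA' hU
    rw [← Matrix.mulVec_transpose, Matrix.mulVec_mulVec] at hAw
    have := Matrix.eq_zero_of_mulVec_eq_zero h1.ne' hAw
    simp [this] at hwm
  · exact ⟨(Fin.castLEOrderEmb (by omega)).trans f, fun j => hf (Fin.castLE (by omega) j)⟩

/-- A nonzero vector in the kernel of a totally positive matrix strictly alternates along `k + 1`
positions: the previous lemma is applied to the columns in the support of the vector. -/
theorem exists_strictly_alternating_of_mulVec_eq_zero {n k : ℕ} {A : Matrix (Fin k) (Fin n) ℝ}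
    (hkn : k ≤ n) (hA : ∀ I : Fin k ↪o Fin n, 0 < (A.submatrix id I).det)
    {y : Fin n → ℝ} (hy : y ≠ 0) (hAy : A.mulVec y = 0) :
    ∃ (f : Fin (k + 1) ↪o Fin n) (t : ℝ), t ≠ 0 ∧
      ∀ j : Fin (k + 1), 0 < t * (-1) ^ (j : ℕ) * y (f j) := by
  classical
  set S : Finset (Fin n) := Finset.univ.filter fun i => y i ≠ 0 with hS
  obtain ⟨T, hST, hkT, hT⟩ : ∃ T, S ⊆ T ∧ k ≤ T.card ∧ (k < T.card → T = S) := by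
    rcases le_or_gt k S.card with h | h
    · exact ⟨S, subset_rfl, h, fun _ => rfl⟩
    · obtain ⟨T, hST, hT⟩ := Finset.exists_superset_card_eq h.le (by simpa using hkn)
      exact ⟨T, hST, hT.ge, fun h => absurd hT h.ne'⟩
  set e := T.orderEmbOfFin rfl with he
  have hsum : ∀ g : Fin n → ℝ, ∑ i, g i * y i = ∑ j, g (e j) * y (e j) := by
    intro g
    have h1 : ∑ i ∈ T, g i * y i = ∑ i, g i * y i := by
      refine Finset.sum_subset (Finset.subset_univ _) fun i _ hi => ?_
      have : y i = 0 := by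
        by_contra h
        exact hi (hST (by simp [hS, h]))
      rw [this, mul_zero]
    rw [← h1]
    refine Eq.trans (Finset.sum_congr ?_ fun _ _ => rfl)
      (Finset.sum_map Finset.univ e.toEmbedding fun i => g i * y i)
    ext i
    have := Finset.range_orderEmbOfFin T rfl
    rw [Set.ext_iff] at this
    simp [he]
  have hye : y ∘ e ≠ 0 := by
    intro h
    refine hy (dotProduct_self_eq_zero.1 ((hsum y).trans ?_))
    refine Finset.sum_eq_zero fun j _ => ?_
    have : y (e j) = 0 := congrFun h j
    rw [this, mul_zero]
  obtain ⟨m, hym, hm⟩ := exists_first_ne_zero hye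
  obtain ⟨f, hf⟩ := exists_alternating_of_mulVec_eq_zero (A := A.submatrix id e)
    (w := y ∘ e) (fun I => (hA (I.trans e)).le)
    ⟨Fin.castLEOrderEmb hkT, hA ((Fin.castLEOrderEmb hkT).trans e)⟩ (by
      ext i
      have := congrFun hAy i
      simp only [Matrix.mulVec, dotProduct] at this ⊢
      rw [hsum] at this
      exact this) hym hm
  have hcard : k < T.card := by
    have := Fintype.card_le_of_embedding f.toEmbedding
    simpa using this
  have ht : (-1) ^ (m : ℕ) * (y ∘ e) m ≠ 0 := mul_ne_zero (pow_ne_zero _ (by norm_num)) hym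
  refine ⟨f.trans e, _, ht, fun j => lt_of_le_of_ne (hf j) (Ne.symm ?_)⟩
  refine mul_ne_zero (mul_ne_zero ht (pow_ne_zero _ (by norm_num))) ?_
  have h1 : e (f j) ∈ T := Finset.orderEmbOfFin_mem _ _ _
  have h2 : ∀ i ∈ T, y i ≠ 0 := fun i hi => by
    rw [hT hcard] at hi
    simpa [hS] using hi
  exact h2 _ h1

/-- Linear independence of the rows of a matrix, in terms of row combinations. -/
theorem linearIndependent_toLp_iff {n k : ℕ} {A : Matrix (Fin k) (Fin n) ℝ} :
    LinearIndependent ℝ (fun i => WithLp.toLp 2 (A i) : Fin k → EuclideanSpace ℝ (Fin n)) ↔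
      ∀ c : Fin k → ℝ, Matrix.vecMul c A = 0 → c = 0 := by
  rw [Fintype.linearIndependent_iff]
  refine forall_congr' fun c => ?_
  have : (∑ i, c i • (WithLp.toLp 2 (A i) : EuclideanSpace ℝ (Fin n))) = 0 ↔
      Matrix.vecMul c A = 0 := by
    constructor
    · intro h
      ext j
      have := congrArg (fun v : EuclideanSpace ℝ (Fin n) => v j) h
      simpa [Matrix.vecMul, dotProduct] using this
    · intro h
      ext j
      have := congrFun h j
      simpa [Matrix.vecMul, dotProduct] using this
  rw [this]
  exact imp_congr_right fun _ => ⟨fun h => funext h, fun h i => congrFun h i⟩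

/-- The hyperplane of `ℝ^(k+1)` orthogonal to a nonzero weakly alternating vector `u` is totally
nonnegative: its maximal minors are, up to a common factor, the absolute values of the entries
of `u`. -/
theorem exists_nonneg_minors_orthogonal {k : ℕ} {u : Fin (k + 1) → ℝ} (hu : u ≠ 0) {t : ℝ}
    (ht : t ≠ 0) (h : ∀ j : Fin (k + 1), 0 ≤ t * (-1) ^ (j : ℕ) * u j) :
    ∃ C : Matrix (Fin k) (Fin (k + 1)) ℝ, (∀ c : Fin k → ℝ, Matrix.vecMul c C = 0 → c = 0) ∧
      C.mulVec u = 0 ∧ ∀ j : Fin (k + 1), 0 ≤ (C.submatrix id j.succAbove).det := by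
  -- the rows of `C` are a basis of the orthogonal complement of `u`
  set φ : (Fin (k + 1) → ℝ) →ₗ[ℝ] ℝ := ∑ j, u j • LinearMap.proj j with hφ
  have hφa : ∀ x, φ x = ∑ j, x j * u j := fun x => by simp [hφ, mul_comm]
  have hφu : 0 < φ u := by
    rw [hφa]
    refine lt_of_le_of_ne (Finset.sum_nonneg fun j _ => mul_self_nonneg _) fun h0 => hu ?_
    exact dotProduct_self_eq_zero.1 h0.symm
  have hrank : Module.finrank ℝ (LinearMap.ker φ) = k := by
    have := Module.Dual.finrank_ker_add_one_of_ne_zero (f := φ) (fun h0 => by simp [h0] at hφu)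
    simpa using this
  set b := Module.finBasisOfFinrankEq ℝ (LinearMap.ker φ) hrank with hb
  set C : Matrix (Fin k) (Fin (k + 1)) ℝ := Matrix.of fun i => (b i : Fin (k + 1) → ℝ) with hC
  have hCv : ∀ c : Fin k → ℝ, Matrix.vecMul c C = ((∑ i, c i • b i : LinearMap.ker φ) :) := by
    intro c
    ext j
    simp [hC, Matrix.vecMul, dotProduct]
  have hCind : ∀ c : Fin k → ℝ, Matrix.vecMul c C = 0 → c = 0 := by
    intro c hc
    rw [hCv] at hc
    exact funext (Fintype.linearIndependent_iff.1 b.linearIndependent c (Subtype.ext hc))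
  have hCu : C.mulVec u = 0 := by
    ext i
    have := (b i).2
    rw [LinearMap.mem_ker, hφa] at this
    exact this
  -- both sides are linear in `x` and agree on `u` and on the rows of `C`
  have hlin : ∀ x, altSum C (RelEmbedding.refl _) x * φ u =
      φ x * altSum C (RelEmbedding.refl _) u := by
    intro x
    have hx : x - (φ x / φ u) • u ∈ LinearMap.ker φ := by
      rw [LinearMap.mem_ker, map_sub, map_smul, smul_eq_mul, div_mul_cancel₀ _ hφu.ne', sub_self]
    have h1 : x = Matrix.vecMul (b.repr ⟨_, hx⟩) C + (φ x / φ u) • u := by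
      rw [hCv, b.sum_repr]
      simp
    have h2 := congrArg (altSum C (RelEmbedding.refl _)) h1
    rw [altSum_add, altSum_vecMul, zero_add, altSum_smul] at h2
    rw [h2]
    field_simp
  set D := altSum C (RelEmbedding.refl _) u with hD
  have hdet : ∀ j : Fin (k + 1), (C.submatrix id j.succAbove).det * φ u =
      (-1) ^ (j : ℕ) * u j * D := by
    intro j
    have h1 := hlin (Pi.single j 1)
    have h2 : altSum C (RelEmbedding.refl _) (Pi.single j 1) =
        (-1) ^ (j : ℕ) * (C.submatrix id j.succAbove).det := by
      rw [altSum, Finset.sum_eq_single j]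
      · rw [RelEmbedding.refl_apply, Pi.single_eq_same, mul_one]
        rfl
      · intro i _ hij
        rw [RelEmbedding.refl_apply, Pi.single_eq_of_ne hij]
        ring
      · simp
    have h3 : φ (Pi.single j 1) = u j := by
      rw [hφa, Finset.sum_eq_single j]
      · simp
      · intro i _ hij
        rw [Pi.single_eq_of_ne hij, zero_mul]
      · simp
    rw [h2, h3] at h1
    have h4 : ((-1 : ℝ) ^ (j : ℕ)) * (-1) ^ (j : ℕ) = 1 := by rw [← mul_pow]; simp
    calc _ = ((-1 : ℝ) ^ (j : ℕ) * (-1) ^ (j : ℕ)) * ((C.submatrix id j.succAbove).det * φ u) := by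
            rw [h4, one_mul]
      _ = (-1) ^ (j : ℕ) * ((-1) ^ (j : ℕ) * (C.submatrix id j.succAbove).det * φ u) := by ring
      _ = _ := by rw [h1]; ring
  have hsign : ∀ j : Fin (k + 1), 0 ≤ t * D * (C.submatrix id j.succAbove).det := by
    intro j
    refine nonneg_of_mul_nonneg_left (b := φ u) ?_ hφu
    rw [mul_assoc, hdet]
    calc (0 : ℝ) ≤ (t * (-1) ^ (j : ℕ) * u j) * (D * D) := mul_nonneg (h j) (mul_self_nonneg _)
      _ = _ := by ring
  rcases Nat.eq_zero_or_pos k with rfl | hk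
  · exact ⟨C, hCind, hCu, fun j => by simp⟩
  -- one row is rescaled to correct the common sign of the minors
  set E : Matrix (Fin k) (Fin k) ℝ :=
    Matrix.diagonal (Function.update 1 ⟨0, hk⟩ (if 0 ≤ t * D then 1 else -1)) with hE
  have hEdet : E.det = if 0 ≤ t * D then 1 else -1 := by
    rw [hE, Matrix.det_diagonal, Finset.prod_update_of_mem (Finset.mem_univ _)]
    simp
  refine ⟨E * C, fun c hc => ?_, ?_, fun j => ?_⟩
  · rw [← Matrix.vecMul_vecMul] at hc
    refine Matrix.eq_zero_of_vecMul_eq_zero (M := E) ?_ (hCind _ hc)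
    rw [hEdet]
    split_ifs <;> norm_num
  · rw [← Matrix.mulVec_mulVec, hCu, Matrix.mulVec_zero]
  · have : (E * C).submatrix id j.succAbove = E * C.submatrix id j.succAbove := by
      ext a b
      simp [Matrix.mul_apply]
    rw [this, Matrix.det_mul, hEdet]
    have hj := hsign j
    rcases lt_trichotomy (t * D) 0 with h0 | h0 | h0
    · rw [if_neg (not_le.2 h0)]
      have := nonpos_of_mul_nonneg_right hj h0
      linarith
    · have hD0 : D = 0 := (mul_eq_zero.1 h0).resolve_left ht
      have := hdet j
      rw [hD0, mul_zero] at this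
      rw [(mul_eq_zero.1 this).resolve_right hφu.ne', mul_zero]
    · rw [if_pos h0.le, one_mul]
      exact nonneg_of_mul_nonneg_right hj h0

/-- A vector that weakly alternates along `k + 1` positions is orthogonal to a totally
nonnegative space of dimension `k`, supported in these positions. -/
theorem exists_nonneg_minors_mulVec_eq_zero {n k : ℕ} {w : Fin n → ℝ} {f : Fin (k + 1) ↪o Fin n}
    {t : ℝ} (ht : t ≠ 0) (h : ∀ j : Fin (k + 1), 0 ≤ t * (-1) ^ (j : ℕ) * w (f j)) :
    ∃ A : Matrix (Fin k) (Fin n) ℝ, (∀ c : Fin k → ℝ, Matrix.vecMul c A = 0 → c = 0) ∧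
      A.mulVec w = 0 ∧ ∀ I : Fin k ↪o Fin n, 0 ≤ (A.submatrix id I).det := by
  classical
  obtain ⟨C, hC, hCw, hmin⟩ : ∃ C : Matrix (Fin k) (Fin (k + 1)) ℝ,
      (∀ c : Fin k → ℝ, Matrix.vecMul c C = 0 → c = 0) ∧ C.mulVec (w ∘ f) = 0 ∧
      ∀ j : Fin (k + 1), 0 ≤ (C.submatrix id j.succAbove).det := by
    by_cases hu : w ∘ f = 0
    · obtain ⟨C, hC, -, hmin⟩ := exists_nonneg_minors_orthogonal (k := k) (t := 1)
        (u := fun j => (-1) ^ (j : ℕ)) (fun h => by simpa using congrFun h 0)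
        one_ne_zero (fun j => by rw [one_mul]; exact mul_self_nonneg _)
      exact ⟨C, hC, by rw [hu, Matrix.mulVec_zero], hmin⟩
    · exact exists_nonneg_minors_orthogonal hu ht h
  have hext : ∀ i j, Function.extend f (C i) 0 (f j) = C i j := fun i j =>
    f.injective.extend_apply _ _ _
  refine ⟨Matrix.of fun i => Function.extend f (C i) 0, fun c hc => hC c ?_, ?_, fun I => ?_⟩
  · ext j
    have := congrFun hc (f j)
    simpa [Matrix.vecMul, dotProduct, hext] using this
  · ext i
    have h1 := congrFun hCw i
    simp only [Matrix.mulVec, dotProduct, Matrix.of_apply, Pi.zero_apply] at h1 ⊢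
    rw [← h1, ← Finset.sum_subset (Finset.subset_univ (Finset.univ.map f.toEmbedding)),
      Finset.sum_map]
    · simp [hext]
    · intro x _ hx
      rw [Function.extend_apply', Pi.zero_apply, zero_mul]
      rintro ⟨j, rfl⟩
      exact hx (by simp)
  · by_cases hI : ∃ i, I i ∉ Set.range f
    · obtain ⟨i, hi⟩ := hI
      rw [Matrix.det_eq_zero_of_column_eq_zero i]
      intro l
      simp only [Matrix.submatrix_apply, Matrix.of_apply]
      rw [Function.extend_apply' _ _ _ hi]
      rfl
    · push Not at hI
      choose g hg using hI
      have hgm : StrictMono g := fun a b hab => by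
        rw [← f.lt_iff_lt, hg, hg]
        exact I.strictMono hab
      -- an increasing map `Fin k → Fin (k + 1)` omits exactly one value
      obtain ⟨j, hj⟩ : ∃ j, ∀ i, g i ≠ j := by
        by_contra! hcon
        have := Fintype.card_le_of_surjective g hcon
        simp at this
      have hgj : g = j.succAbove := by
        refine (hgm.range_inj (Fin.strictMono_succAbove j)).1 ?_
        have h1 : Finset.univ.image g ⊆ Finset.univ.image j.succAbove := by
          intro x hx
          obtain ⟨i, -, rfl⟩ := Finset.mem_image.1 hx
          obtain ⟨y, hy⟩ := Fin.exists_succAbove_eq (hj i)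
          exact Finset.mem_image.2 ⟨y, Finset.mem_univ _, hy⟩
        have h2 := Finset.eq_of_subset_of_card_le h1 (by
          rw [Finset.card_image_of_injective _ hgm.injective,
            Finset.card_image_of_injective _ Fin.succAbove_right_injective])
        simpa using congrArg (fun s : Finset (Fin (k + 1)) => (s : Set (Fin (k + 1)))) h2
      have : (Matrix.of fun i => Function.extend f (C i) 0).submatrix id I =
          C.submatrix id j.succAbove := by
        ext a b
        simp only [Matrix.submatrix_apply, Matrix.of_apply, id]
        rw [← hg b, hext, hgj]
      rw [this]
      exact hmin j

/-! ### Sign vectors of totally nonnegative subspaces and their orthogonal complements -/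

theorem le_varBar_signVec_iff {n k : ℕ} {w : EuclideanSpace ℝ (Fin n)} :
    (k : ℤ) ≤ varBar (signVec w) ↔ ∃ (f : Fin (k + 1) ↪o Fin n) (t : ℝ), t ≠ 0 ∧
      ∀ j : Fin (k + 1), 0 ≤ t * (-1) ^ (j : ℕ) * w (f j) := by
  rw [le_varBar_iff]
  constructor
  · rintro ⟨f, s, hs, hf⟩
    have hs' : SignType.sign (s : ℝ) = s := signType_sign_coe s
    have hs0 : (s : ℝ) ≠ 0 := by rwa [← sign_ne_zero, hs']
    refine ⟨f, s, hs0, (weaklyAlternates_sign_iff hs0).1 ?_⟩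
    rw [hs']
    exact hf
  · rintro ⟨f, t, ht, hf⟩
    exact ⟨f, SignType.sign t, sign_ne_zero.2 ht, (weaklyAlternates_sign_iff ht).2 hf⟩

theorem Represents.mem_iff {n k : ℕ} {A : Matrix (Fin k) (Fin n) ℝ}
    {V : Submodule ℝ (EuclideanSpace ℝ (Fin n))} (h : Represents A V)
    {v : EuclideanSpace ℝ (Fin n)} : v ∈ V ↔ ∃ c, Matrix.vecMul c A = v.ofLp := by
  rw [← h.2, Submodule.mem_span_range_iff_exists_fun]
  refine exists_congr fun c => ?_
  constructor
  · rintro rfl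
    ext j
    simp [Matrix.vecMul, dotProduct]
  · intro h
    ext j
    rw [← h]
    simp [Matrix.vecMul, dotProduct]

theorem Represents.mem_orthogonal_iff {n k : ℕ} {A : Matrix (Fin k) (Fin n) ℝ}
    {V : Submodule ℝ (EuclideanSpace ℝ (Fin n))} (h : Represents A V)
    {w : EuclideanSpace ℝ (Fin n)} : w ∈ Vᗮ ↔ A.mulVec w.ofLp = 0 := by
  have key : ∀ i, inner ℝ (WithLp.toLp 2 (A i) : EuclideanSpace ℝ (Fin n)) w =
      A.mulVec w.ofLp i := fun i => by
    simp [PiLp.inner_apply, Matrix.mulVec, dotProduct, mul_comm]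
  constructor
  · intro hw
    ext i
    rw [← key]
    refine Submodule.inner_right_of_mem_orthogonal ?_ hw
    rw [← h.2]
    exact Submodule.subset_span ⟨i, rfl⟩
  · intro hw
    rw [← h.2, Submodule.mem_orthogonal]
    intro u hu
    induction hu using Submodule.span_induction with
    | mem x hx =>
      obtain ⟨i, rfl⟩ := hx
      rw [key, hw]
      rfl
    | zero => simp
    | add x y _ _ hx hy => rw [inner_add_left, hx, hy, add_zero]
    | smul a x _ hx => rw [inner_smul_left, hx, mul_zero]

theorem Represents.le {n k : ℕ} {A : Matrix (Fin k) (Fin n) ℝ}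
    {V : Submodule ℝ (EuclideanSpace ℝ (Fin n))} (h : Represents A V) : k ≤ n := by
  simpa using h.1.fintype_card_le_finrank

theorem Represents.finrank_eq {n k : ℕ} {A : Matrix (Fin k) (Fin n) ℝ}
    {V : Submodule ℝ (EuclideanSpace ℝ (Fin n))} (h : Represents A V) :
    Module.finrank ℝ V = k := by
  rw [← h.2, finrank_span_eq_card h.1, Fintype.card_fin]

/-- Nonzero elements of a totally positive space vary little. -/
theorem IsTotallyPositive.varBar_lt {n k : ℕ} {V : Submodule ℝ (EuclideanSpace ℝ (Fin n))}
    (hV : IsTotallyPositive k V) {v : EuclideanSpace ℝ (Fin n)} (hv : v ∈ V) (hv0 : v ≠ 0) :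
    varBar (signVec v) < k := by
  obtain ⟨A, hA, hpos⟩ := hV
  by_contra! h
  obtain ⟨f, t, ht, hf⟩ := le_varBar_signVec_iff.1 h
  obtain ⟨c, hc⟩ := hA.mem_iff.1 hv
  simp only [← hc] at hf
  have := eq_zero_of_alternating hpos ht hf
  rw [this, Matrix.zero_vecMul] at hc
  exact hv0 (WithLp.ofLp_injective 2 hc.symm)

theorem IsTotallyNonneg.exists_alternating {n k : ℕ} {V : Submodule ℝ (EuclideanSpace ℝ (Fin n))}
    (hV : IsTotallyNonneg k V) {w : EuclideanSpace ℝ (Fin n)} (hw : w ∈ Vᗮ)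
    {m : Fin n} (hwm : w m ≠ 0) (hm : ∀ i < m, w i = 0) :
    ∃ f : Fin (k + 1) ↪o Fin n,
      ∀ j : Fin (k + 1), 0 ≤ (-1) ^ (m : ℕ) * w m * (-1) ^ (j : ℕ) * w (f j) := by
  obtain ⟨A, hA, hnn⟩ := hV
  obtain ⟨I, hI⟩ := exists_det_submatrix_ne_zero (linearIndependent_toLp_iff.1 hA.1)
  exact exists_alternating_of_mulVec_eq_zero hnn ⟨I, lt_of_le_of_ne (hnn I) hI.symm⟩
    (hA.mem_orthogonal_iff.1 hw) hwm hm

/-- Nonzero vectors orthogonal to a totally nonnegative space vary a lot. -/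
theorem IsTotallyNonneg.le_varBar {n k : ℕ} {V : Submodule ℝ (EuclideanSpace ℝ (Fin n))}
    (hV : IsTotallyNonneg k V) {w : EuclideanSpace ℝ (Fin n)} (hw : w ∈ Vᗮ) (hw0 : w ≠ 0) :
    (k : ℤ) ≤ varBar (signVec w) := by
  obtain ⟨m, hwm, hm⟩ := exists_first_ne_zero (w := w.ofLp)
    fun h => hw0 (WithLp.ofLp_injective 2 h)
  obtain ⟨f, hf⟩ := hV.exists_alternating hw hwm hm
  exact le_varBar_signVec_iff.2 ⟨f, _, mul_ne_zero (pow_ne_zero _ (by norm_num)) hwm, hf⟩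

/-- Converse of `IsTotallyNonneg.le_varBar`. -/
theorem exists_isTotallyNonneg_mem_orthogonal {n k : ℕ} {w : EuclideanSpace ℝ (Fin n)}
    (h : (k : ℤ) ≤ varBar (signVec w)) : ∃ V, IsTotallyNonneg k V ∧ w ∈ Vᗮ := by
  obtain ⟨f, t, ht, hf⟩ := le_varBar_signVec_iff.1 h
  obtain ⟨A, hA, hAw, hnn⟩ := exists_nonneg_minors_mulVec_eq_zero ht hf
  have hrep : Represents A _ := ⟨linearIndependent_toLp_iff.2 hA, rfl⟩
  exact ⟨_, ⟨A, hrep, hnn⟩, hrep.mem_orthogonal_iff.2 hAw⟩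

/-- A theorem of the alternative, by separation of convex sets: if `σ` is not the sign vector of an
element of `V`, then some element of `Vᗮ` agrees with `σ` weakly, and not trivially, on the support
of `σ`. -/
theorem exists_signVec_eq_or_exists_orthogonal {n : ℕ}
    (V : Submodule ℝ (EuclideanSpace ℝ (Fin n))) (σ : SignVec n) :
    (∃ v ∈ V, signVec v = σ) ∨
      ∃ y ∈ Vᗮ, (∀ i, 0 ≤ (σ i : ℝ) * y i) ∧ ∃ i, (σ i : ℝ) * y i ≠ 0 := by
  by_contra! hcon
  obtain ⟨hV, hy⟩ := hcon
  -- `V ⊓ K` is disjoint from the open convex cone `O` of vectors with the signs of `σ` on its support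
  let K : Submodule ℝ (EuclideanSpace ℝ (Fin n)) :=
    { carrier := {v | ∀ i, σ i = 0 → v i = 0}
      add_mem' := fun {a b} ha hb i hi => by simp [ha i hi, hb i hi]
      zero_mem' := fun i _ => rfl
      smul_mem' := fun c v hv i hi => by simp [hv i hi] }
  have hK : ∀ v, v ∈ K ↔ ∀ i, σ i = 0 → v i = 0 := fun v => Iff.rfl
  let O : Set (EuclideanSpace ℝ (Fin n)) := {u | ∀ i, σ i ≠ 0 → 0 < (σ i : ℝ) * u i}
  have hOc : Convex ℝ O := by
    intro x hx y hy a b ha hb hab i hi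
    have h1 := hx i hi
    have h2 := hy i hi
    simp only [PiLp.add_apply, PiLp.smul_apply, smul_eq_mul]
    have : (σ i : ℝ) * (a * x i + b * y i) = a * (σ i * x i) + b * (σ i * y i) := by ring
    rw [this]
    rcases ha.lt_or_eq with h | h
    · exact add_pos_of_pos_of_nonneg (mul_pos h h1) (mul_nonneg hb h2.le)
    · rw [← h, zero_add] at hab
      rw [← h, hab]
      linarith
  have hOo : IsOpen O := by
    have : O = ⋂ i, {u | σ i ≠ 0 → 0 < (σ i : ℝ) * u i} := by ext; simp [O]
    rw [this]
    refine isOpen_iInter_of_finite fun i => ?_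
    by_cases hi : σ i = 0
    · simp [hi]
    · simp only [ne_eq, hi, not_false_eq_true, forall_const]
      exact isOpen_lt (by fun_prop) (by fun_prop)
  have hsc : ∀ s : SignType, s ≠ 0 → (s : ℝ) * s = 1 := by
    intro s hs; cases s <;> simp at hs ⊢
  have hdisj : Disjoint O ((V ⊓ K : Submodule ℝ _) : Set (EuclideanSpace ℝ (Fin n))) := by
    rw [Set.disjoint_left]
    rintro v hvO ⟨hvV, hvK⟩
    refine hV v hvV (funext fun i => ?_)
    change SignType.sign (v i) = σ i
    by_cases hi : σ i = 0
    · rw [hi, hvK i hi, sign_zero]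
    · have h1 := hvO i hi
      revert h1 hi
      generalize σ i = s
      intro hi h1
      cases s
      · exact absurd rfl hi
      · exact sign_neg (by simpa using h1)
      · exact sign_pos (by simpa using h1)
  obtain ⟨φ, r, hφO, hφL⟩ := geometric_hahn_banach_open hOc hOo (V ⊓ K).convex hdisj
  have hr : r ≤ 0 := by simpa using hφL 0 (V ⊓ K).zero_mem
  have hφ0 : ∀ v ∈ V ⊓ K, φ v = 0 := by
    intro v hv
    by_contra h0
    have := hφL (((r - 1) / φ v) • v) ((V ⊓ K).smul_mem _ hv)
    rw [map_smul, smul_eq_mul, div_mul_cancel₀ _ h0] at this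
    linarith
  -- the separating functional is positive on `O` and vanishes on `V ⊓ K`
  set y₀ := (InnerProductSpace.toDual ℝ (EuclideanSpace ℝ (Fin n))).symm (-φ) with hy₀
  have hin : ∀ v, inner ℝ y₀ v = -φ v := fun v => by
    rw [hy₀, InnerProductSpace.toDual_symm_apply]; rfl
  have hy₀L : y₀ ∈ (V ⊓ K)ᗮ := by
    rw [Submodule.mem_orthogonal']
    intro v hv
    rw [hin, hφ0 v hv, neg_zero]
  have hL : (V ⊓ K)ᗮ = Vᗮ ⊔ Kᗮ := by
    rw [← Submodule.orthogonal_orthogonal (Vᗮ ⊔ Kᗮ), ← Submodule.inf_orthogonal,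
      Submodule.orthogonal_orthogonal, Submodule.orthogonal_orthogonal]
  rw [hL] at hy₀L
  obtain ⟨y, hyV, z, hzK, hyz⟩ := Submodule.mem_sup.1 hy₀L
  -- the summand in `Kᗮ` lives off the support of `σ` and may be discarded
  have hz : ∀ i, σ i ≠ 0 → z i = 0 := by
    intro i hi
    have h1 : EuclideanSpace.single i (1 : ℝ) ∈ K := by
      rw [hK]
      intro j hj
      have : j ≠ i := fun h => hi (h ▸ hj)
      simp [this]
    have h2 := Submodule.inner_right_of_mem_orthogonal h1 hzK
    rw [EuclideanSpace.inner_single_left] at h2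
    simpa using h2
  have hσy : ∀ i, (σ i : ℝ) * y i = σ i * y₀ i := by
    intro i
    by_cases hi : σ i = 0
    · simp [hi]
    · rw [← hyz, PiLp.add_apply, hz i hi, add_zero]
  set q : EuclideanSpace ℝ (Fin n) := WithLp.toLp 2 fun i => (σ i : ℝ) with hq
  -- testing the functional on these elements of `O` shows that `σ i * y i` is nonnegative
  have hqO : ∀ (a : ℝ) i, 0 ≤ a → q + EuclideanSpace.single i (a * (σ i : ℝ)) ∈ O := by
    intro a i ha j hj
    by_cases hij : j = i
    · subst hij
      simp only [hq, PiLp.add_apply, PiLp.single_apply, if_true]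
      have := hsc _ hj
      nlinarith
    · simp [hq, hij, hsc _ hj]
  have hpair : ∀ (a : ℝ) i, inner ℝ y₀ (q + EuclideanSpace.single i (a * (σ i : ℝ))) =
      (∑ i, (σ i : ℝ) * y i) + a * (σ i * y i) := by
    intro a i
    rw [inner_add_right, EuclideanSpace.inner_single_right, hσy]
    simp only [hσy, PiLp.inner_apply, hq]
    simp
    ring
  have hpos : ∀ (a : ℝ) i, 0 ≤ a → 0 < (∑ i, (σ i : ℝ) * y i) + a * (σ i * y i) := by
    intro a i ha
    rw [← hpair, hin]
    have := hφO _ (hqO a i ha)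
    linarith
  have hnn : ∀ i, 0 ≤ (σ i : ℝ) * y i := by
    intro i
    by_contra! h
    have h1 := hpos 0 i le_rfl
    rw [zero_mul, add_zero] at h1
    have h2 := hpos ((∑ i, (σ i : ℝ) * y i) / -(σ i * y i)) i (div_nonneg h1.le (by linarith))
    rw [div_neg, neg_mul, div_mul_cancel₀ _ h.ne] at h2
    linarith
  have hz0 := hy y hyV hnn
  rcases isEmpty_or_nonempty (Fin n) with he | ⟨⟨i⟩⟩
  · exact hV 0 V.zero_mem (Subsingleton.elim _ _)
  · have := hpos 0 i le_rfl
    simp [hz0] at this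

/-- Every sign vector `σ` with `varBar σ < k` occurs in a totally positive space of
dimension `k`, since an obstructing orthogonal vector would strictly alternate along `k + 1`
positions. -/
theorem IsTotallyPositive.exists_signVec_eq {n k : ℕ}
    {V : Submodule ℝ (EuclideanSpace ℝ (Fin n))} (hV : IsTotallyPositive k V) {σ : SignVec n}
    (hσ : varBar σ < k) : ∃ v ∈ V, signVec v = σ := by
  refine (exists_signVec_eq_or_exists_orthogonal V σ).resolve_right ?_
  rintro ⟨y, hy, hnn, i, hi⟩
  obtain ⟨A, hA, hpos⟩ := hV
  obtain ⟨f, t, ht, hf⟩ := exists_strictly_alternating_of_mulVec_eq_zero hA.le hpos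
    (y := y.ofLp) (fun h => hi (by rw [h]; simp)) (hA.mem_orthogonal_iff.1 hy)
  refine not_le.2 hσ ((le_varBar_iff σ k).2 ⟨f, SignType.sign t, sign_ne_zero.2 ht, fun j => ?_⟩)
  have h1 := sign_pos (hf j)
  have h2 := hnn (f j)
  have h3 : y (f j) ≠ 0 := fun h => by simp [h] at h1
  rw [sign_mul, sign_mul, sign_pow, Left.sign_neg, sign_one] at h1
  revert h1 h2
  generalize SignType.sign t * (-1) ^ (j : ℕ) = a
  generalize σ (f j) = s
  intro h1 h2
  rcases lt_or_gt_of_ne h3 with h | h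
  · rw [sign_neg h] at h1
    cases s
    · exact Or.inl rfl
    · right; revert h1; cases a <;> decide
    · simp at h2; linarith
  · rw [sign_pos h] at h1
    cases s
    · exact Or.inl rfl
    · simp at h2; linarith
    · right; revert h1; cases a <;> decide

/-! ### Homogeneous coordinates and orientation -/

section Coordinates

variable {n k : ℕ} {W : Submodule ℝ (EuclideanSpace ℝ (Fin n))}
  (b : Module.Basis (Fin (k + 1)) ℝ W)

theorem repr_vecAt_zero (x : EuclideanSpace ℝ (Fin k)) : b.repr (vecAt b x) 0 = 1 := by
  simp [vecAt, Fin.succ_ne_zero]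

theorem repr_vecAt_succ (x : EuclideanSpace ℝ (Fin k)) (j : Fin k) :
    b.repr (vecAt b x) j.succ = x j := by
  simp [vecAt, Finsupp.single_apply]

/-- The point of `ℝ^k` with homogeneous coordinates `b.repr w`; a junk value if `b.repr w 0 = 0`. -/
noncomputable def affinePoint (w : W) : EuclideanSpace ℝ (Fin k) :=
  WithLp.toLp 2 fun j => b.repr w j.succ / b.repr w 0

theorem affinePoint_vecAt (x : EuclideanSpace ℝ (Fin k)) : affinePoint b (vecAt b x) = x := by
  ext j
  simp [affinePoint, repr_vecAt_zero, repr_vecAt_succ]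

theorem vecAt_affinePoint {w : W} (hw : b.repr w 0 ≠ 0) :
    w = b.repr w 0 • vecAt b (affinePoint b w) := by
  refine b.repr.injective (Finsupp.ext fun i => ?_)
  rw [map_smul, Finsupp.smul_apply, smul_eq_mul]
  refine Fin.cases ?_ (fun j => ?_) i
  · rw [repr_vecAt_zero, mul_one]
  · rw [repr_vecAt_succ, affinePoint, mul_div_cancel₀ _ hw]

theorem mk_eq_Psi_affinePoint {w : W} (hw : w ≠ 0) (h0 : b.repr w 0 ≠ 0) :
    Projectivization.mk ℝ w hw = Psi b (affinePoint b w) :=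
  (Projectivization.mk_eq_mk_iff' ℝ _ _ _ _).2 ⟨b.repr w 0, (vecAt_affinePoint b h0).symm⟩

theorem coe_sub_smul_mem_linearPart (w : W) :
    (w : EuclideanSpace ℝ (Fin n)) - b.repr w 0 • ((b 0 : W) : EuclideanSpace ℝ (Fin n)) ∈
      linearPart b := by
  have h : w - b.repr w 0 • b 0 = ∑ j : Fin k, b.repr w j.succ • b j.succ := by
    nth_rewrite 1 [← b.sum_repr w]
    rw [Fin.sum_univ_succ]
    abel
  have h' := congrArg (fun v : W => (v : EuclideanSpace ℝ (Fin n))) h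
  simp only [Submodule.coe_sub, Submodule.coe_smul, Submodule.coe_sum] at h'
  rw [h']
  exact Submodule.sum_mem _ fun j _ => Submodule.smul_mem _ _ (Submodule.subset_span ⟨j, rfl⟩)

theorem mem_linearPart_of_repr_eq_zero {w : W} (hw : b.repr w 0 = 0) :
    (w : EuclideanSpace ℝ (Fin n)) ∈ linearPart b := by
  simpa [hw] using coe_sub_smul_mem_linearPart b w

theorem linearPart_le : linearPart b ≤ W := by
  rw [linearPart, Submodule.span_le]
  rintro _ ⟨j, rfl⟩
  exact (b j.succ).2

theorem exists_vecAt_add_smul {v : EuclideanSpace ℝ (Fin n)} (hv : v ∈ linearPart b) :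
    ∃ y : EuclideanSpace ℝ (Fin k), ∀ (x : EuclideanSpace ℝ (Fin k)) (t : ℝ),
      (vecAt b (x + t • y) : EuclideanSpace ℝ (Fin n)) = vecAt b x + t • v := by
  obtain ⟨y, hy⟩ := Submodule.mem_span_range_iff_exists_fun ℝ |>.1 hv
  refine ⟨WithLp.toLp 2 y, fun x t => ?_⟩
  simp only [vecAt, ← hy, Submodule.coe_add, Submodule.coe_sum, Submodule.coe_smul, PiLp.add_apply,
    PiLp.smul_apply, add_smul, Finset.sum_add_distrib, smul_eq_mul, Finset.smul_sum, mul_smul]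
  abel

/-- `altSum A f` vanishes on the linear part, so on `W` it is a multiple of the coordinate along
`b 0`. -/
theorem altSum_coe {A : Matrix (Fin k) (Fin n) ℝ} (hA : Represents A (linearPart b))
    (f : Fin (k + 1) ↪o Fin n) (w : W) :
    altSum A f (w : EuclideanSpace ℝ (Fin n)).ofLp =
      b.repr w 0 * altSum A f ((b 0 : W) : EuclideanSpace ℝ (Fin n)).ofLp := by
  obtain ⟨c, hc⟩ := hA.mem_iff.1 (coe_sub_smul_mem_linearPart b w)
  have : (w : EuclideanSpace ℝ (Fin n)).ofLp = Matrix.vecMul c A +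
      b.repr w 0 • ((b 0 : W) : EuclideanSpace ℝ (Fin n)).ofLp := by
    rw [hc]
    ext i
    simp
  rw [this, altSum_add, altSum_vecMul, zero_add, altSum_smul]

end Coordinates

theorem mul_altSum_nonneg {n k : ℕ} {A : Matrix (Fin k) (Fin n) ℝ}
    (hA : ∀ I : Fin k ↪o Fin n, 0 < (A.submatrix id I).det) {w : Fin n → ℝ}
    {f : Fin (k + 1) ↪o Fin n} {t : ℝ}
    (h : ∀ j : Fin (k + 1), 0 ≤ t * (-1) ^ (j : ℕ) * w (f j)) : 0 ≤ t * altSum A f w := by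
  rw [altSum, Finset.mul_sum]
  refine Finset.sum_nonneg fun j _ => ?_
  rw [← mul_assoc, ← mul_assoc]
  exact mul_nonneg (h j) (hA _).le

/-- The meaning of the orientation condition: adding `b 0` as a first row to a totally positive
matrix of the linear part gives positive maximal minors. Up to a common factor these are the minors
of a totally positive matrix of `W`, so it suffices to find a single positive one; it comes from an
alternating subsequence of the component of `b 0` orthogonal to the linear part. -/
theorem altSum_basis_zero_pos {n k : ℕ} {W : Submodule ℝ (EuclideanSpace ℝ (Fin n))}
    (hW : IsTotallyPositive (k + 1) W) {b : Module.Basis (Fin (k + 1)) ℝ W}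
    (hb : IsPositivelyOriented (linearPart b) ((b 0 : W) : EuclideanSpace ℝ (Fin n)))
    {A : Matrix (Fin k) (Fin n) ℝ} (hA : Represents A (linearPart b))
    (hApos : ∀ I : Fin k ↪o Fin n, 0 < (A.submatrix id I).det) (f : Fin (k + 1) ↪o Fin n) :
    0 < altSum A f ((b 0 : W) : EuclideanSpace ℝ (Fin n)).ofLp := by
  obtain ⟨u, ⟨huV, -⟩, hbu, m, hm0, hm⟩ := hb
  have heq : ∀ f, altSum A f ((b 0 : W) : EuclideanSpace ℝ (Fin n)).ofLp = altSum A f u.ofLp := by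
    intro f
    obtain ⟨c, hc⟩ := hA.mem_iff.1 hbu
    have : ((b 0 : W) : EuclideanSpace ℝ (Fin n)).ofLp = Matrix.vecMul c A + u.ofLp := by
      rw [hc]; simp
    rw [this, altSum_add, altSum_vecMul, zero_add]
  have huW : u ∈ W := by
    have := W.sub_mem (b 0).2 (linearPart_le b hbu)
    simpa using this
  obtain ⟨B, hB, hBpos⟩ := hW
  -- the rows of the enlarged matrix are combinations of the rows of `B`
  have hrow : ∀ i : Fin (k + 1), ∃ c, Matrix.vecMul c B =
      (Fin.cons u.ofLp A : Fin (k + 1) → Fin n → ℝ) i := by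
    refine Fin.cases (hB.mem_iff.1 huW) fun i => ?_
    have hi : WithLp.toLp 2 (A i) ∈ linearPart b := by
      rw [← hA.2]
      exact Submodule.subset_span ⟨i, rfl⟩
    exact hB.mem_iff.1 (linearPart_le b hi)
  choose M hM using hrow
  have hdet : ∀ f : Fin (k + 1) ↪o Fin n, altSum A f u.ofLp =
      (Matrix.of M).det * (B.submatrix id f).det := by
    intro f
    rw [altSum_eq_det, ← Matrix.det_mul]
    congr 1
    ext i j
    exact (congrFun (hM i) (f j)).symm
  obtain ⟨g, hg⟩ := IsTotallyNonneg.exists_alternating ⟨A, hA, fun I => (hApos I).le⟩ huV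
    (m := m) hm.ne' (fun i hi => by
      have : (i : ℕ) < m := hi
      omega)
  have hnn := mul_altSum_nonneg hApos hg
  rw [hm0, pow_zero, one_mul] at hnn hg
  have hgnn : 0 ≤ altSum A g u.ofLp := nonneg_of_mul_nonneg_right hnn hm
  have hM0 : (Matrix.of M).det ≠ 0 := by
    intro h0
    -- otherwise `u` vanishes at `k + 1` positions
    have hz := hdet g
    rw [h0, zero_mul, altSum] at hz
    have hg' : ∀ j : Fin (k + 1), 0 ≤ (-1) ^ (j : ℕ) * u (g j) := fun j => by
      have := hg j
      rw [mul_assoc] at this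
      exact nonneg_of_mul_nonneg_right this hm
    rw [Finset.sum_eq_zero_iff_of_nonneg fun j _ => mul_nonneg (hg' j) (hApos _).le] at hz
    have hug : ∀ j, u (g j) = 0 := fun j => by
      have h1 := (mul_eq_zero.1 (hz j (Finset.mem_univ j))).resolve_right (hApos _).ne'
      exact (mul_eq_zero.1 h1).resolve_left (pow_ne_zero _ (by norm_num))
    obtain ⟨c, hc⟩ := hB.mem_iff.1 huW
    have hc0 : c = 0 := Matrix.eq_zero_of_vecMul_eq_zero (hBpos g).ne' (by
      ext j
      have := congrFun hc (g j)
      rw [hug] at this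
      exact this)
    rw [hc0, Matrix.zero_vecMul] at hc
    have := congrFun hc m
    exact hm.ne this
  rw [heq, hdet]
  rw [hdet] at hgnn
  exact mul_pos (lt_of_le_of_ne (nonneg_of_mul_nonneg_left hgnn (hBpos g)) hM0.symm) (hBpos f)

/-- If `w ∈ W` has the maximal possible value `k` of `varBar`, its coordinate along `b 0` is nonzero
and its sign is determined by the first nonzero entry of `w`. -/
theorem first_entry_mul_repr_pos {n k : ℕ} {W : Submodule ℝ (EuclideanSpace ℝ (Fin n))}
    (hW : IsTotallyPositive (k + 1) W) {b : Module.Basis (Fin (k + 1)) ℝ W} (hb : IsCyclicBasis b)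
    {w : W} (hw : (k : ℤ) ≤ varBar (signVec (w : EuclideanSpace ℝ (Fin n)))) {m : Fin n}
    (hwm : (w : EuclideanSpace ℝ (Fin n)) m ≠ 0)
    (hm : ∀ i < m, (w : EuclideanSpace ℝ (Fin n)) i = 0) :
    0 < (-1) ^ (m : ℕ) * (w : EuclideanSpace ℝ (Fin n)) m * b.repr w 0 := by
  obtain ⟨V, hV, hwV⟩ := exists_isTotallyNonneg_mem_orthogonal hw
  obtain ⟨f, hf⟩ := hV.exists_alternating hwV hwm hm
  obtain ⟨A, hA, hApos⟩ := hb.1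
  have h1 := mul_altSum_nonneg hApos hf
  rw [altSum_coe b hA, ← mul_assoc] at h1
  refine lt_of_le_of_ne
    (nonneg_of_mul_nonneg_left h1 (altSum_basis_zero_pos hW hb.2 hA hApos f)) (Ne.symm ?_)
  refine mul_ne_zero (mul_ne_zero (pow_ne_zero _ (by norm_num)) hwm) fun h0 => ?_
  exact not_lt.2 hw (hb.1.varBar_lt (mem_linearPart_of_repr_eq_zero b h0)
    fun h => hwm (by rw [h]; rfl))

/-! ### Labels of the bounded faces -/

section Faces

variable {n k : ℕ} {W : Submodule ℝ (EuclideanSpace ℝ (Fin n))}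

theorem signVec_ne_zero {v : EuclideanSpace ℝ (Fin n)} (hv : v ≠ 0) : signVec v ≠ 0 := by
  intro h
  refine hv (WithLp.ofLp_injective 2 (funext fun i => ?_))
  exact sign_eq_zero_iff.1 (congrFun h i)

theorem ne_zero_of_signVec_ne_zero {v : EuclideanSpace ℝ (Fin n)} (hv : signVec v ≠ 0) : v ≠ 0 := by
  rintro rfl
  exact hv (funext fun i => by simp [signVec])

theorem signVec_smul_of_pos {v : EuclideanSpace ℝ (Fin n)} {t : ℝ} (ht : 0 < t) :
    signVec (t • v) = signVec v := by
  funext i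
  simp [signVec, sign_mul, sign_pos ht]

theorem signVec_neg (v : EuclideanSpace ℝ (Fin n)) : signVec (-v) = -signVec v := by
  funext i
  simp [signVec, Left.sign_neg]

theorem varBar_signVec_le (hW : IsTotallyPositive (k + 1) W) {w : W} (hw : w ≠ 0) :
    varBar (signVec (w : EuclideanSpace ℝ (Fin n))) ≤ k := by
  have := hW.varBar_lt w.2 (by simpa using hw)
  push_cast at this
  omega

theorem psi_mem_signBar (hW : IsTotallyPositive (k + 1) W)
    {b : Module.Basis (Fin (k + 1)) ℝ W} (hb : IsCyclicBasis b) {x : EuclideanSpace ℝ (Fin k)}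
    (hx : (k : ℤ) ≤ varBar (psi b x)) : psi b x ∈ signBar n k := by
  have h0 : (vecAt b x : EuclideanSpace ℝ (Fin n)) ≠ 0 := by simpa using vecAt_ne_zero b x
  refine ⟨signVec_ne_zero h0, le_antisymm (varBar_signVec_le hW (vecAt_ne_zero b x)) hx,
    fun m hm hm' => ?_⟩
  have hpos := first_entry_mul_repr_pos hW hb hx (m := m) (sign_ne_zero.1 hm)
    fun i hi => sign_eq_zero_iff.1 (hm' i hi)
  rw [repr_vecAt_zero, mul_one] at hpos
  have := sign_pos hpos
  rw [sign_mul, sign_pow, Left.sign_neg, sign_one] at this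
  change SignType.sign _ = _
  revert this
  rcases neg_one_pow_eq_or SignType (m : ℕ) with h | h <;> rw [h] <;>
    generalize SignType.sign ((vecAt b x : EuclideanSpace ℝ (Fin n)) m) = s <;> revert s <;> decide

theorem repr_pos_of_signVec_mem_signBar (hW : IsTotallyPositive (k + 1) W)
    {b : Module.Basis (Fin (k + 1)) ℝ W} (hb : IsCyclicBasis b) {w : W}
    (hw : signVec (w : EuclideanSpace ℝ (Fin n)) ∈ signBar n k) : 0 < b.repr w 0 := by
  obtain ⟨h0, hk, hfirst⟩ := hw
  obtain ⟨m, hwm, hm⟩ := exists_first_ne_zero h0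
  have h1 := hfirst m hwm hm
  have hpos := first_entry_mul_repr_pos hW hb hk.ge (m := m) (sign_ne_zero.1 hwm)
    fun i hi => sign_eq_zero_iff.1 (hm i hi)
  refine pos_of_mul_pos_right hpos (le_of_lt ?_)
  rw [← sign_eq_one_iff, sign_mul, sign_pow, Left.sign_neg, sign_one]
  change SignType.sign _ = _ at h1
  rw [h1, ← mul_pow]
  simp

/-- A vector of `W` with sign vector in `signBar n k` has a positive coordinate along `b 0`, so it can
be rescaled to `vecAt b x` without changing signs. -/
theorem Psi_image_face (hW : IsTotallyPositive (k + 1) W)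
    {b : Module.Basis (Fin (k + 1)) ℝ W} (hb : IsCyclicBasis b) {σ : SignVec n}
    (hσ : σ ∈ signBar n k) : Psi b '' face b σ = stratum W σ := by
  ext p
  constructor
  · rintro ⟨x, hx, rfl⟩
    exact ⟨vecAt b x, vecAt_ne_zero b x, rfl, Or.inl hx⟩
  · have key : ∀ (w : W) (hw : w ≠ 0), signVec (w : EuclideanSpace ℝ (Fin n)) = σ →
        Projectivization.mk ℝ w hw ∈ Psi b '' face b σ := by
      intro w hw hwσ
      have hpos := repr_pos_of_signVec_mem_signBar hW hb (hwσ.symm ▸ hσ)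
      refine ⟨affinePoint b w, ?_, (mk_eq_Psi_affinePoint b hw hpos.ne').symm⟩
      change signVec _ = σ
      rw [← hwσ]
      conv_rhs => rw [vecAt_affinePoint b hpos.ne', Submodule.coe_smul, signVec_smul_of_pos hpos]
    rintro ⟨w, hw, rfl, h | h⟩
    · exact key w hw h
    · have := key (-w) (neg_ne_zero.2 hw) (by rw [Submodule.coe_neg, signVec_neg, h, neg_neg])
      rwa [(Projectivization.mk_eq_mk_iff' ℝ (-w) w (neg_ne_zero.2 hw) hw).2 ⟨-1, by simp⟩] at this

theorem face_nonempty (hW : IsTotallyPositive (k + 1) W)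
    {b : Module.Basis (Fin (k + 1)) ℝ W} (hb : IsCyclicBasis b) {σ : SignVec n}
    (hσ : σ ∈ signBar n k) : (face b σ).Nonempty := by
  rw [← Set.image_nonempty, Psi_image_face hW hb hσ]
  obtain ⟨w, hw, hwσ⟩ := hW.exists_signVec_eq (σ := σ) (by rw [hσ.2.1]; push_cast; omega)
  have hw0 : (⟨w, hw⟩ : W) ≠ 0 := fun h =>
    ne_zero_of_signVec_ne_zero (hwσ.symm ▸ hσ.1) (congrArg Subtype.val h)
  exact ⟨_, ⟨w, hw⟩, hw0, rfl, Or.inl hwσ⟩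

/-- On a face whose label weakly alternates along `k + 1` positions, the identity
`altSum A f w = const` bounds the entries of `vecAt b x` in these positions, since all the terms of
the sum have the same sign; and these entries determine `x`. -/
theorem isBounded_face {b : Module.Basis (Fin (k + 1)) ℝ W} (hb : IsCyclicBasis b) {σ : SignVec n}
    (hσ : (k : ℤ) ≤ varBar σ) : Bornology.IsBounded (face b σ) := by
  obtain ⟨f, s, hs, hf⟩ := (le_varBar_iff σ k).1 hσ
  obtain ⟨A, hA, hApos⟩ := hb.1
  have hs' : SignType.sign (s : ℝ) = s := signType_sign_coe s
  have hs0 : (s : ℝ) ≠ 0 := by rwa [← sign_ne_zero, hs']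
  have hs1 : |(s : ℝ)| = 1 := by cases s <;> simp at hs0 ⊢
  set C := altSum A f ((b 0 : W) : EuclideanSpace ℝ (Fin n)).ofLp with hC
  -- the entries of `vecAt b x` at the first `k` of the positions, as a function of `x`
  let L : EuclideanSpace ℝ (Fin k) →ₗ[ℝ] (Fin (k + 1) → ℝ) :=
    { toFun := fun x l => ∑ j, x j * ((b j.succ : W) : EuclideanSpace ℝ (Fin n)) (f l)
      map_add' := fun x y => by ext l; simp [add_mul, Finset.sum_add_distrib]
      map_smul' := fun c x => by ext l; simp [Finset.mul_sum, mul_assoc] }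
  have hLv : ∀ x l, L x l = (vecAt b x : EuclideanSpace ℝ (Fin n)) (f l) -
      ((b 0 : W) : EuclideanSpace ℝ (Fin n)) (f l) := by
    intro x l
    simp [L, vecAt]
  have hker : LinearMap.ker L = ⊥ := by
    rw [LinearMap.ker_eq_bot']
    intro x hx
    set v : W := ∑ j : Fin k, x j • b j.succ with hv
    have hv0 : b.repr v 0 = 0 := by simp [hv, Fin.succ_ne_zero]
    obtain ⟨c, hc⟩ := hA.mem_iff.1 (mem_linearPart_of_repr_eq_zero b hv0)
    have hc0 : c = 0 := by
      refine eq_zero_of_alternating hApos (f := f) one_ne_zero fun j => ?_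
      have h2 : (v : EuclideanSpace ℝ (Fin n)) (f j) = L x j := by simp [hv, L]
      rw [hc, h2, hx]
      simp
    rw [hc0, Matrix.zero_vecMul] at hc
    have hv' : v = 0 := Subtype.ext (WithLp.ofLp_injective 2 hc.symm)
    have h3 : vecAt b x = vecAt b 0 := by
      have e1 : vecAt b x = v + b 0 := rfl
      rw [e1, hv', zero_add]
      simp [vecAt]
    rw [← affinePoint_vecAt b x, h3, affinePoint_vecAt]
  obtain ⟨K, -, hK⟩ := L.exists_antilipschitzWith hker
  -- a bound for `L` on the face
  have hbd : ∀ x ∈ face b σ, ∀ l, |L x l| ≤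
      |C| / (A.submatrix id ((Fin.succAboveOrderEmb l).trans f)).det +
        |((b 0 : W) : EuclideanSpace ℝ (Fin n)) (f l)| := by
    intro x hx l
    have hx' : signVec (vecAt b x : EuclideanSpace ℝ (Fin n)) = σ := hx
    rw [← hx', ← hs'] at hf
    have h1 := (weaklyAlternates_sign_iff hs0).1 hf
    have h2 := altSum_coe b hA f (vecAt b x)
    rw [repr_vecAt_zero, one_mul, ← hC] at h2
    have h3 : (s : ℝ) * (-1) ^ (l : ℕ) * (vecAt b x : EuclideanSpace ℝ (Fin n)) (f l) *
        (A.submatrix id ((Fin.succAboveOrderEmb l).trans f)).det ≤ s * C := by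
      rw [← h2, altSum, Finset.mul_sum]
      refine le_trans (le_of_eq ?_) (Finset.single_le_sum (f := fun j : Fin (k + 1) => (s : ℝ) *
        ((-1) ^ (j : ℕ) * (vecAt b x : EuclideanSpace ℝ (Fin n)).ofLp (f j) *
        (A.submatrix id ((Fin.succAboveOrderEmb j).trans f)).det)) (fun j _ => ?_)
        (Finset.mem_univ l))
      · simp only [mul_assoc]
      · have := mul_nonneg (h1 j) (hApos ((Fin.succAboveOrderEmb j).trans f)).le
        simpa only [mul_assoc] using this
    have h4 : |(vecAt b x : EuclideanSpace ℝ (Fin n)) (f l)| ≤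
        |C| / (A.submatrix id ((Fin.succAboveOrderEmb l).trans f)).det := by
      rw [le_div_iff₀ (hApos _)]
      have e1 : |(s : ℝ) * (-1) ^ (l : ℕ) * (vecAt b x : EuclideanSpace ℝ (Fin n)) (f l)| =
          |(vecAt b x : EuclideanSpace ℝ (Fin n)) (f l)| := by
        rw [abs_mul, abs_mul, hs1, abs_pow]
        simp
      rw [← e1, abs_of_nonneg (h1 l)]
      refine h3.trans ((le_abs_self _).trans ?_)
      rw [abs_mul, hs1, one_mul]
    rw [hLv]
    exact (abs_sub _ _).trans (by linarith)
  have hball : Bornology.IsBounded (L '' face b σ) := by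
    rw [isBounded_iff_forall_norm_le]
    refine ⟨∑ l, (|C| / (A.submatrix id ((Fin.succAboveOrderEmb l).trans f)).det +
        |((b 0 : W) : EuclideanSpace ℝ (Fin n)) (f l)|), ?_⟩
    rintro _ ⟨x, hx, rfl⟩
    have hnn : ∀ l, 0 ≤ |C| / (A.submatrix id ((Fin.succAboveOrderEmb l).trans f)).det +
        |((b 0 : W) : EuclideanSpace ℝ (Fin n)) (f l)| := fun l =>
      add_nonneg (div_nonneg (abs_nonneg _) (hApos _).le) (abs_nonneg _)
    rw [pi_norm_le_iff_of_nonneg (Finset.sum_nonneg fun l _ => hnn l)]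
    intro l
    exact (hbd x hx l).trans (Finset.single_le_sum (fun l _ => hnn l) (Finset.mem_univ l))
  exact (hK.isBounded_preimage hball).subset (Set.subset_preimage_image _ _)

/-- A face whose label has `varBar σ < k` contains a half-line, in a direction of the linear part
with sign vector `σ`. -/
theorem not_isBounded_face {b : Module.Basis (Fin (k + 1)) ℝ W} (hb : IsCyclicBasis b)
    {σ : SignVec n} (hne : (face b σ).Nonempty) (hσ : varBar σ < k) :
    ¬ Bornology.IsBounded (face b σ) := by
  intro hbdd
  obtain ⟨x, hx⟩ := hne
  have hx' : signVec (vecAt b x : EuclideanSpace ℝ (Fin n)) = σ := hx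
  obtain ⟨v, hv, hvσ⟩ := hb.1.exists_signVec_eq hσ
  obtain ⟨y, hy⟩ := exists_vecAt_add_smul b hv
  have hmem : ∀ t : ℝ, 0 ≤ t → x + t • y ∈ face b σ := by
    intro t ht
    change signVec _ = σ
    rw [hy]
    funext i
    have h1 : SignType.sign _ = σ i := congrFun hx' i
    have h2 : SignType.sign _ = σ i := congrFun hvσ i
    change SignType.sign ((vecAt b x : EuclideanSpace ℝ (Fin n)) i + t * v i) = σ i
    generalize σ i = s at h1 h2
    cases s
    · have h1' := sign_eq_zero_iff.1 h1
      have h2' := sign_eq_zero_iff.1 h2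
      rw [h1', h2', mul_zero, add_zero, sign_zero]
      rfl
    · have h1' := sign_eq_neg_one_iff.1 h1
      have h2' := sign_eq_neg_one_iff.1 h2
      exact sign_neg (add_neg_of_neg_of_nonpos h1' (mul_nonpos_of_nonneg_of_nonpos ht h2'.le))
    · have h1' := sign_eq_one_iff.1 h1
      have h2' := sign_eq_one_iff.1 h2
      exact sign_pos (add_pos_of_pos_of_nonneg h1' (mul_nonneg ht h2'.le))
  have hy0 : y ≠ 0 := by
    rintro rfl
    have h1 := hy x 1
    rw [smul_zero, add_zero, one_smul, left_eq_add] at h1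
    refine signVec_ne_zero (v := (vecAt b x : EuclideanSpace ℝ (Fin n)))
      (by simpa using vecAt_ne_zero b x) ?_
    rw [hx', ← hvσ, h1]
    funext i
    simp [signVec]
  obtain ⟨R, hR⟩ := isBounded_iff_forall_norm_le.1 hbdd
  have hypos := norm_pos_iff.2 hy0
  have hR0 : 0 ≤ R := (norm_nonneg _).trans (hR x hx)
  set t := (R + ‖x‖ + 1) / ‖y‖ with ht
  have ht0 : 0 ≤ t := by positivity
  have h1 := hR _ (hmem t ht0)
  have h2 : ‖t • y‖ ≤ ‖x + t • y‖ + ‖x‖ := by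
    have := norm_sub_le (x + t • y) x
    simpa using this
  rw [norm_smul, Real.norm_of_nonneg ht0, ht, div_mul_cancel₀ _ hypos.ne'] at h2
  linarith

theorem boundedLabels_eq (hW : IsTotallyPositive (k + 1) W)
    {b : Module.Basis (Fin (k + 1)) ℝ W} (hb : IsCyclicBasis b) :
    boundedLabels b = signBar n k := by
  ext σ
  constructor
  · rintro ⟨⟨x, hx⟩, hbdd⟩
    have hk : (k : ℤ) ≤ varBar σ := by
      by_contra! h
      exact not_isBounded_face hb ⟨x, hx⟩ h hbdd
    have hx' : psi b x = σ := hx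
    rw [← hx'] at hk ⊢
    exact psi_mem_signBar hW hb hk
  · intro hσ
    exact ⟨face_nonempty hW hb hσ, isBounded_face hb hσ.2.1.ge⟩

/-! ### Closures -/

/-- Nonzero signs persist nearby, which gives one direction; for the other, the half-open segment
from a point of the smaller face to one of the larger face stays in the larger face. -/
theorem face_subset_closure_iff {b : Module.Basis (Fin (k + 1)) ℝ W} {σ τ : SignVec n}
    (hσ : (face b σ).Nonempty) (hτ : (face b τ).Nonempty) :
    face b σ ⊆ closure (face b τ) ↔ signLE σ τ := by
  have hcont : ∀ i, Continuous fun x => (vecAt b x : EuclideanSpace ℝ (Fin n)) i := by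
    intro i
    simp only [vecAt, Submodule.coe_add, Submodule.coe_sum, Submodule.coe_smul, PiLp.add_apply,
      WithLp.ofLp_sum, Finset.sum_apply, PiLp.smul_apply, smul_eq_mul]
    fun_prop
  constructor
  · intro h i hi
    obtain ⟨x, hx⟩ := hσ
    have hx' : psi b x = σ := hx
    -- the sign of a nonzero entry is constant near `x`
    have hopen : ∀ᶠ z in nhds x, psi b z i = σ i := by
      rw [← hx'] at hi ⊢
      have hi' : (vecAt b x : EuclideanSpace ℝ (Fin n)) i ≠ 0 := sign_ne_zero.1 hi
      rcases lt_or_gt_of_ne hi' with h0 | h0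
      · filter_upwards [(hcont i).continuousAt.eventually (gt_mem_nhds h0)] with z hz
        exact (sign_neg hz).trans (sign_neg h0).symm
      · filter_upwards [(hcont i).continuousAt.eventually (lt_mem_nhds h0)] with z hz
        exact (sign_pos hz).trans (sign_pos h0).symm
    obtain ⟨z, hz, hzτ⟩ := (mem_closure_iff_frequently.1 (h hx)).and_eventually hopen |>.exists
    have hz' : psi b z = τ := hz
    rw [← hzτ, hz']
  · rintro hle x hx
    obtain ⟨z, hz⟩ := hτ
    have hx' : psi b x = σ := hx
    have hz' : psi b z = τ := hz
    have hmem : ∀ t : ℝ, 0 < t → t < 1 → x + t • (z - x) ∈ face b τ := by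
      intro t ht0 ht1
      change psi b _ = τ
      funext i
      have e : (vecAt b (x + t • (z - x)) : EuclideanSpace ℝ (Fin n)) i =
          (1 - t) * (vecAt b x : EuclideanSpace ℝ (Fin n)) i +
            t * (vecAt b z : EuclideanSpace ℝ (Fin n)) i := by
        simp only [vecAt, Submodule.coe_add, Submodule.coe_sum, Submodule.coe_smul, PiLp.add_apply,
          WithLp.ofLp_sum, Finset.sum_apply, PiLp.smul_apply, smul_eq_mul, PiLp.sub_apply]
        rw [mul_add, mul_add, Finset.mul_sum, Finset.mul_sum, add_add_add_comm,
          ← Finset.sum_add_distrib]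
        congr 1
        · exact Finset.sum_congr rfl fun j _ => by ring
        · ring
      have h1 : SignType.sign ((vecAt b x : EuclideanSpace ℝ (Fin n)) i) = σ i := congrFun hx' i
      have h2 : SignType.sign ((vecAt b z : EuclideanSpace ℝ (Fin n)) i) = τ i := congrFun hz' i
      change SignType.sign _ = _
      rw [e, ← h2]
      have h3 := hle i
      rw [← h1, ← h2] at h3
      have h1t : 0 < 1 - t := by linarith
      by_cases h0 : SignType.sign ((vecAt b x : EuclideanSpace ℝ (Fin n)) i) = 0
      · rw [sign_eq_zero_iff.1 h0, mul_zero, zero_add, sign_mul, sign_pos ht0, one_mul]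
      · have h4 := h3 h0
        rcases lt_or_gt_of_ne (sign_ne_zero.1 h0) with h5 | h5
        · rw [sign_neg h5] at h4
          have h6 := sign_eq_neg_one_iff.1 h4.symm
          rw [← h4]
          exact sign_neg (add_neg (mul_neg_of_pos_of_neg h1t h5) (mul_neg_of_pos_of_neg ht0 h6))
        · rw [sign_pos h5] at h4
          have h6 := sign_eq_one_iff.1 h4.symm
          rw [← h4]
          exact sign_pos (add_pos (mul_pos h1t h5) (mul_pos ht0 h6))
    have hlim : Filter.Tendsto (fun t : ℝ => x + t • (z - x)) (nhdsWithin 0 (Set.Ioi 0))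
        (nhds x) := by
      have : Continuous fun t : ℝ => x + t • (z - x) := by fun_prop
      have h := this.tendsto 0
      rw [zero_smul, add_zero] at h
      exact h.mono_left nhdsWithin_le_nhds
    refine mem_closure_of_tendsto hlim ?_
    filter_upwards [Ioo_mem_nhdsGT (zero_lt_one (α := ℝ))] with t ht
    exact hmem t ht.1 ht.2

/-! ### The chart `Ψ` of the projective space of `W` -/

theorem Psi_injective (b : Module.Basis (Fin (k + 1)) ℝ W) : Function.Injective (Psi b) := by
  intro x y h
  obtain ⟨a, ha⟩ := (Projectivization.mk_eq_mk_iff' ℝ _ _ _ _).1 h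
  have h1 := congrArg (fun v => b.repr v 0) ha
  simp only [map_smul, Finsupp.smul_apply, repr_vecAt_zero, smul_eq_mul, mul_one] at h1
  rw [h1, one_smul] at ha
  rw [← affinePoint_vecAt b x, ← ha, affinePoint_vecAt]

theorem continuous_vecAt (b : Module.Basis (Fin (k + 1)) ℝ W) : Continuous (vecAt b) := by
  unfold vecAt
  fun_prop

/-- `Psi b` is the affine chart where the coordinate along `b 0` does not vanish, with inverse
`affinePoint b`. -/
theorem isOpenEmbedding_Psi (b : Module.Basis (Fin (k + 1)) ℝ W) :
    Topology.IsOpenEmbedding (Psi b) := by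
  refine Topology.IsOpenEmbedding.of_continuous_injective_isOpenMap ?_ (Psi_injective b) ?_
  · exact continuous_coinduced_rng.comp ((continuous_vecAt b).subtype_mk (vecAt_ne_zero b))
  · intro U hU
    rw [isOpen_coinduced]
    have hc : ∀ i, Continuous fun w : {w : W // w ≠ 0} => b.repr (w : W) i := fun i => by
      have : Continuous (b.coord i) := LinearMap.continuous_of_finiteDimensional _
      exact this.comp continuous_subtype_val
    have hset : Projectivization.mk' ℝ ⁻¹' (Psi b '' U) =
        {w : {w : W // w ≠ 0} | b.repr (w : W) 0 ≠ 0} ∩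
          {w | affinePoint b (w : W) ∈ U} := by
      ext w
      constructor
      · rintro ⟨x, hx, hxw⟩
        obtain ⟨a, ha⟩ := (Projectivization.mk_eq_mk_iff' ℝ (vecAt b x) (w : W) _ w.2).1 hxw
        have ha0 : a ≠ 0 := by
          rintro rfl
          rw [zero_smul] at ha
          exact vecAt_ne_zero b x ha.symm
        have h1 : a * b.repr (w : W) 0 = 1 := by
          rw [← repr_vecAt_zero b x, ← ha]
          simp
        have hw0 : b.repr (w : W) 0 ≠ 0 := fun h => by simp [h] at h1
        refine ⟨hw0, ?_⟩
        have : affinePoint b (w : W) = x := Psi_injective b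
          ((mk_eq_Psi_affinePoint b w.2 hw0).symm.trans hxw.symm)
        change affinePoint b (w : W) ∈ U
        rwa [this]
      · rintro ⟨h0, hU'⟩
        exact ⟨_, hU', (mk_eq_Psi_affinePoint b w.2 h0).symm⟩
    rw [hset]
    have hopen : IsOpen {w : {w : W // w ≠ 0} | b.repr (w : W) 0 ≠ 0} :=
      isOpen_ne_fun (hc 0) continuous_const
    refine ContinuousOn.isOpen_inter_preimage (f := fun w : {w : W // w ≠ 0} =>
      affinePoint b (w : W)) ?_ hopen hU
    refine (PiLp.continuous_toLp 2 _).comp_continuousOn ?_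
    exact continuousOn_pi.2 fun j => (hc j.succ).continuousOn.div (hc 0).continuousOn fun w hw => hw

/-! ### The amplituhedron -/

theorem lineOf_mk {w : W} (hw : w ≠ 0) :
    lineOf (Projectivization.mk ℝ w hw) = Submodule.span ℝ {(w : EuclideanSpace ℝ (Fin n))} := by
  rw [lineOf, Projectivization.submodule_mk, Submodule.map_span, Set.image_singleton]
  rfl

theorem finrank_orthogonal_inf (hW : IsTotallyPositive (k + 1) W)
    {b : Module.Basis (Fin (k + 1)) ℝ W} (hb : IsCyclicBasis b)
    {V : Submodule ℝ (EuclideanSpace ℝ (Fin n))} (hV : IsTotallyNonneg k V) :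
    Module.finrank ℝ (Vᗮ ⊓ W : Submodule ℝ (EuclideanSpace ℝ (Fin n))) = 1 := by
  refine le_antisymm ?_ ?_
  · -- the coordinate along `b 0` is injective on `Vᗮ ⊓ W`
    let φ : (Vᗮ ⊓ W : Submodule ℝ (EuclideanSpace ℝ (Fin n))) →ₗ[ℝ] ℝ :=
      (b.coord 0).comp (Submodule.inclusion inf_le_right)
    have hinj : Function.Injective φ := by
      rw [← LinearMap.ker_eq_bot, LinearMap.ker_eq_bot']
      intro w hw
      by_contra h0
      have h1 : (w : EuclideanSpace ℝ (Fin n)) ∈ linearPart b :=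
        mem_linearPart_of_repr_eq_zero b (w := Submodule.inclusion inf_le_right w) hw
      have h2 : (w : EuclideanSpace ℝ (Fin n)) ≠ 0 := by simpa using h0
      exact not_lt.2 (hV.le_varBar w.2.1 h2) (hb.1.varBar_lt h1 h2)
    simpa using LinearMap.finrank_le_finrank_of_injective hinj
  · obtain ⟨A, hA, -⟩ := hV
    obtain ⟨B, hB, -⟩ := hW
    have h1 := Submodule.finrank_sup_add_finrank_inf_eq Vᗮ W
    have h2 := V.finrank_add_finrank_orthogonal
    have h3 := Submodule.finrank_le (Vᗮ ⊔ W)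
    rw [hA.finrank_eq] at h2
    rw [hB.finrank_eq] at h1
    omega

/-- The sign rule in `signBar` selects a representative modulo `±1`, so it loses no stratum. -/
theorem exists_mem_signBar_stratum_eq {σ : SignVec n} (h0 : σ ≠ 0) (hk : varBar σ = k) :
    ∃ τ ∈ signBar n k, stratum W σ = stratum W τ := by
  obtain ⟨m, hσm, hm⟩ := exists_first_ne_zero h0
  have huniq : ∀ τ : SignVec n, (∀ i < m, τ i = 0) → ∀ i, τ i ≠ 0 → (∀ j < i, τ j = 0) →
      τ m ≠ 0 → i = m := by
    intro τ hτ i hi hi' hτm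
    rcases lt_trichotomy i m with h | h | h
    · exact absurd (hτ i h) hi
    · exact h
    · exact absurd (hi' m h) hτm
  have hpm : σ m = (-1) ^ (m : ℕ) ∨ (-σ) m = (-1) ^ (m : ℕ) := by
    rw [Pi.neg_apply]
    revert hσm
    rcases neg_one_pow_eq_or SignType (m : ℕ) with h | h <;> rw [h] <;> generalize σ m = s <;>
      revert s <;> decide
  rcases hpm with h | h
  · refine ⟨σ, ⟨h0, hk, fun i hi hi' => ?_⟩, rfl⟩
    rw [huniq σ hm i hi hi' hσm, h]
  · refine ⟨-σ, ⟨fun h' => hσm (by simpa using congrFun h' m), varBar_neg hk, fun i hi hi' => ?_⟩, ?_⟩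
    · rw [huniq (-σ) (fun i hi => by simp [hm i hi]) i hi hi' (by simpa using hσm), h]
    · ext p
      simp only [stratum, neg_neg]
      exact exists_congr fun w => exists_congr fun hw => and_congr_right fun _ => or_comm

/-- A line of `W` is orthogonal to a totally nonnegative space of dimension `k` iff its sign vectors
satisfy `varBar = k`, i.e. iff it lies in a stratum. -/
theorem amplituhedron_eq (hW : IsTotallyPositive (k + 1) W)
    {b : Module.Basis (Fin (k + 1)) ℝ W} (hb : IsCyclicBasis b) :
    amplituhedron k W = Psi b '' boundedComplex b := by
  ext p
  constructor
  · rintro ⟨V, hV, hp⟩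
    induction p with
    | h w hw =>
    rw [lineOf_mk hw] at hp
    have hw0 : (w : EuclideanSpace ℝ (Fin n)) ≠ 0 := by simpa using hw
    have hwV : (w : EuclideanSpace ℝ (Fin n)) ∈ Vᗮ ⊓ W := by
      rw [← hp]
      exact Submodule.mem_span_singleton_self _
    have hk := le_antisymm (varBar_signVec_le hW hw) (hV.le_varBar hwV.1 hw0)
    obtain ⟨τ, hτ, hst⟩ := exists_mem_signBar_stratum_eq (W := W) (signVec_ne_zero hw0) hk
    have hmem : Projectivization.mk ℝ w hw ∈ stratum W τ := by
      rw [← hst]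
      exact ⟨w, hw, rfl, Or.inl rfl⟩
    rw [← Psi_image_face hW hb hτ] at hmem
    refine Set.image_mono ?_ hmem
    refine Set.subset_sUnion_of_mem ⟨τ, ?_, rfl⟩
    rwa [boundedLabels_eq hW hb]
  · rintro ⟨x, ⟨_, ⟨σ, hσ, rfl⟩, hx⟩, rfl⟩
    rw [boundedLabels_eq hW hb] at hσ
    have hx' : psi b x = σ := hx
    obtain ⟨V, hV, hwV⟩ := exists_isTotallyNonneg_mem_orthogonal (k := k)
      (w := (vecAt b x : EuclideanSpace ℝ (Fin n))) (by
        change (k : ℤ) ≤ varBar (psi b x)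
        rw [hx', hσ.2.1])
    refine ⟨V, hV, ?_⟩
    rw [Psi, lineOf_mk]
    refine Submodule.eq_of_le_of_finrank_eq ?_ ?_
    · rw [Submodule.span_singleton_le_iff_mem]
      exact ⟨hwV, (vecAt b x).2⟩
    · rw [finrank_orthogonal_inf hW hb hV, finrank_span_singleton]
      simpa using vecAt_ne_zero b x

end Faces

end CyclicArrangement

theorem mainTheorem2 {n k : ℕ} (W : Submodule ℝ (EuclideanSpace ℝ (Fin n)))
    (hW : CyclicArrangement.IsTotallyPositive (k + 1) W)
    (b : Module.Basis (Fin (k + 1)) ℝ W) (hb : CyclicArrangement.IsCyclicBasis b) :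
    -- every `V^⊥ ∩ W` is a line, so `B_{n,k,1}(W)` is a subset of `ℙ(W)`
    (∀ X ∈ CyclicArrangement.amplituhedronSubspaces k W, Module.finrank ℝ X = 1) ∧
    -- `Ψ` restricts to a homeomorphism from the bounded complex onto `B_{n,k,1}(W)`
    (∃ h : CyclicArrangement.boundedComplex b ≃ₜ CyclicArrangement.amplituhedron k W,
      ∀ x, (h x : ℙ ℝ W) = CyclicArrangement.Psi b x) ∧
    -- the labels of the bounded faces, and the images of these faces
    CyclicArrangement.boundedLabels b = CyclicArrangement.signBar n k ∧
    (∀ σ ∈ CyclicArrangement.signBar n k,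
      CyclicArrangement.Psi b '' CyclicArrangement.face b σ = CyclicArrangement.stratum W σ) ∧
    -- the induced map on strata is an isomorphism of posets
    (∃ e : CyclicArrangement.closureLE (CyclicArrangement.boundedFaces b) ≃r
        CyclicArrangement.closureLE (CyclicArrangement.strata k W),
      ∀ F, (e F : Set (ℙ ℝ W)) = CyclicArrangement.Psi b '' (F : Set (EuclideanSpace ℝ (Fin k)))) ∧
    -- in terms of labels, both orders are the order on sign vectors
    (∀ σ ∈ CyclicArrangement.signBar n k, ∀ τ ∈ CyclicArrangement.signBar n k,
      (CyclicArrangement.face b σ ⊆ closure (CyclicArrangement.face b τ) ↔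
        CyclicArrangement.signLE σ τ) ∧
      (CyclicArrangement.stratum W σ ⊆ closure (CyclicArrangement.stratum W τ) ↔
        CyclicArrangement.signLE σ τ)) := by
  open CyclicArrangement in
  have hemb := (isOpenEmbedding_Psi b).isEmbedding
  have hlab := boundedLabels_eq hW hb
  have hclosure : ∀ F G : Set (EuclideanSpace ℝ (Fin k)),
      Psi b '' F ⊆ closure (Psi b '' G) ↔ F ⊆ closure G := by
    intro F G
    rw [Set.image_subset_iff, ← hemb.closure_eq_preimage_closure_image]
  have hface : ∀ F : boundedFaces b, ∃ σ ∈ signBar n k, (F : Set _) = face b σ := by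
    rintro ⟨_, σ, hσ, rfl⟩
    exact ⟨σ, hlab ▸ hσ, rfl⟩
  refine ⟨?_, ?_, hlab, fun σ hσ => Psi_image_face hW hb hσ, ?_, fun σ hσ τ hτ => ?_⟩
  · rintro _ ⟨V, hV, rfl⟩
    exact finrank_orthogonal_inf hW hb hV
  · exact ⟨(hemb.homeomorphImage (boundedComplex b)).trans
      (Homeomorph.setCongr (amplituhedron_eq hW hb).symm), fun x => rfl⟩
  · let g : boundedFaces b → strata k W := fun F => ⟨Psi b '' F, by
      obtain ⟨σ, hσ, hF⟩ := hface F
      rw [hF, Psi_image_face hW hb hσ]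
      exact ⟨σ, hσ.1, hσ.2.1, rfl⟩⟩
    have hg : Function.Bijective g := by
      constructor
      · intro F G h
        exact Subtype.ext ((Psi_injective b).image_injective (congrArg Subtype.val h))
      · rintro ⟨_, σ, h0, hk, rfl⟩
        obtain ⟨τ, hτ, hst⟩ := exists_mem_signBar_stratum_eq (W := W) h0 hk
        refine ⟨⟨face b τ, τ, hlab ▸ hτ, rfl⟩, Subtype.ext ?_⟩
        change Psi b '' face b τ = _
        exact (Psi_image_face hW hb hτ).trans hst.symm
    exact ⟨⟨Equiv.ofBijective g hg, fun {F G} => hclosure F G⟩, fun F => rfl⟩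
  · have h := face_subset_closure_iff (face_nonempty hW hb hσ) (face_nonempty hW hb hτ)
    rw [← Psi_image_face hW hb hσ, ← Psi_image_face hW hb hτ, hclosure]
    exact ⟨h, h⟩
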